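/- Let $l$ be a nonzero integer and $R>0$. Let $\mathcal C$ be the class of pairs $(A_1,A_2)$ of real functions that are absolutely continuous on $[0,R]$, satisfy $$A_1(0)=A_1(R)=0,\qquad A_2(0)=A_2(R)=0, \tag{1}$$ and have finite energy, i.e. $\big(A_{1,r}^2+A_{2,r}^2+\tfrac{A_1^2}{r^2}+\tfrac{A_2^2}{r^2}+A_1^2A_2\big)r$ is integrable on $(0,R)$. For such pairs put $$I(A_1,A_2)=\frac12\int_0^R\Big(A_{1,r}^2+\frac12A_{2,r}^2+\frac{l^2}{r^2}A_1^2+\frac{2l^2}{r^2}A_2^2-2A_1^2A_2\Big)r\,dr,\qquad Q(A_m)=2\pi\int_0^RA_m^2\,r\,dr,\quad m=1,2.$$ Then for all real $Q_1,Q_2$ with $0<Q_1<2\pi|l|$ and $Q_2>0$ there exist $\kappa,\beta\in\mathbb R$ and a pair $(A_1,A_2)\in\mathcal C$, with $A_1,A_2$ twice continuously differentiable on $(0,R)$, such that: (a) $A_1,A_2$ satisfy (1) and, on $(0,R)$, $$A_{1,rr}+\frac1rA_{1,r}-\frac{l^2}{r^2}A_1=2(\kappa-A_2)A_1,\qquad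 A_{2,rr}+\frac1rA_{2,r}-\frac{4l^2}{r^2}A_2=4(2\kappa+\beta)A_2-2A_1^2;$$ (b) $A_1(r)>0$ and $A_2(r)>0$ for all $r\in(0,R)$; (c) $Q(A_1)=Q_1$, $Q(A_2)=Q_2$, and $(A_1,A_2)$ minimizes $I$ among all pairs $(B_1,B_2)\in\mathcal C$ with $Q(B_1)=Q_1$ and $Q(B_2)=Q_2$; (d) $\kappa,\beta$ arise as Lagrange multipliers of this constrained problem: for every $(\varphi_1,\varphi_2)\in\mathcal C$ the derivatives at $t=0$ below exist and $$\frac{d}{dt}I(A_1+t\varphi_1,A_2+t\varphi_2)\Big|_{t=0}=-\frac{\kappa}{2\pi}\,\frac{d}{dt}Q(A_1+t\varphi_1)\Big|_{t=0}-\frac{2\kappa+\beta}{2\pi}\,\frac{d}{dt}Q(A_2+t\varphi_2)\Big|_{t=0}.$$ -/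

import Mathlib

open Set MeasureTheory

noncomputable section

namespace Vortex

/-- The integrand (with the weight `r` of the measure `r dr`) of the energy
`ℰ(A₁, A₂) = ∫₀ᴿ (A₁'² + A₂'² + A₁²/r² + A₂²/r² + A₁² A₂) r dr`. -/
def energyDensity (A₁ A₂ : ℝ → ℝ) (r : ℝ) : ℝ :=
  (deriv A₁ r ^ 2 + deriv A₂ r ^ 2 + A₁ r ^ 2 / r ^ 2 + A₂ r ^ 2 / r ^ 2 + A₁ r ^ 2 * A₂ r) * r

/-- The boundary conditions `A₁(0) = 0 = A₁(R)`, `A₂(0) = 0 = A₂(R)`. -/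
structure BoundaryCondition (R : ℝ) (A₁ A₂ : ℝ → ℝ) : Prop where
  left₁ : A₁ 0 = 0
  right₁ : A₁ R = 0
  left₂ : A₂ 0 = 0
  right₂ : A₂ R = 0

/-- The admissible class `𝒞`: both functions absolutely continuous on `[0, R]`, vanishing at both
endpoints, of finite energy. -/
structure Admissible (R : ℝ) (A₁ A₂ : ℝ → ℝ) : Prop where
  ac₁ : AbsolutelyContinuousOnInterval A₁ 0 R
  ac₂ : AbsolutelyContinuousOnInterval A₂ 0 R
  bdy : BoundaryCondition R A₁ A₂
  finiteEnergy : IntervalIntegrable (energyDensity A₁ A₂) volume 0 R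

/-- The action functional `I(A₁, A₂)`. -/
def action (l : ℤ) (R : ℝ) (A₁ A₂ : ℝ → ℝ) : ℝ :=
  (1 / 2) * ∫ r in (0 : ℝ)..R,
    (deriv A₁ r ^ 2 + (1 / 2) * deriv A₂ r ^ 2 + (l : ℝ) ^ 2 / r ^ 2 * A₁ r ^ 2
      + 2 * (l : ℝ) ^ 2 / r ^ 2 * A₂ r ^ 2 - 2 * A₁ r ^ 2 * A₂ r) * r

/-- The energy flux `Q(A) = 2π ∫₀ᴿ A² r dr`. -/
def flux (R : ℝ) (A : ℝ → ℝ) : ℝ :=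
  2 * Real.pi * ∫ r in (0 : ℝ)..R, A r ^ 2 * r

/-- `(A₁, A₂)` is a minimizer of `I` over the admissible pairs with fluxes `Q₁`, `Q₂`. -/
structure IsConstrainedMinimizer (l : ℤ) (R Q₁ Q₂ : ℝ) (A₁ A₂ : ℝ → ℝ) : Prop where
  admissible : Admissible R A₁ A₂
  flux₁ : flux R A₁ = Q₁
  flux₂ : flux R A₂ = Q₂
  minimal : ∀ B₁ B₂ : ℝ → ℝ, Admissible R B₁ B₂ → flux R B₁ = Q₁ → flux R B₂ = Q₂ →
    action l R A₁ A₂ ≤ action l R B₁ B₂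

/-- `(A₁, A₂)` is a classical solution, on `(0, R)` and with the boundary values attained
continuously, of the radial `l`-vortex boundary value problem with parameters `κ`, `β`. -/
structure IsVortexSolution (l : ℤ) (R κ β : ℝ) (A₁ A₂ : ℝ → ℝ) : Prop where
  continuous₁ : ContinuousOn A₁ (Icc 0 R)
  continuous₂ : ContinuousOn A₂ (Icc 0 R)
  smooth₁ : ContDiffOn ℝ 2 A₁ (Ioo 0 R)
  smooth₂ : ContDiffOn ℝ 2 A₂ (Ioo 0 R)
  eq₁ : ∀ r ∈ Ioo 0 R,
    deriv (deriv A₁) r + (1 / r) * deriv A₁ r - (l : ℝ) ^ 2 / r ^ 2 * A₁ r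
      = 2 * (κ - A₂ r) * A₁ r
  eq₂ : ∀ r ∈ Ioo 0 R,
    deriv (deriv A₂) r + (1 / r) * deriv A₂ r - 4 * (l : ℝ) ^ 2 / r ^ 2 * A₂ r
      = 4 * (2 * κ + β) * A₂ r - 2 * A₁ r ^ 2
  bdy : BoundaryCondition R A₁ A₂

/-- `μ₁`, `μ₂` are Lagrange multipliers at `(A₁, A₂)` for the action `I` and the constraint
functionals `Q(A₁)`, `Q(A₂)`: in every admissible direction `(φ₁, φ₂)` the three functionals have
directional derivatives `δI`, `δQ₁`, `δQ₂`, and `δI = μ₁ δQ₁ + μ₂ δQ₂`. -/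
def AreLagrangeMultipliers (l : ℤ) (R : ℝ) (A₁ A₂ : ℝ → ℝ) (μ₁ μ₂ : ℝ) : Prop :=
  ∀ φ₁ φ₂ : ℝ → ℝ, Admissible R φ₁ φ₂ → ∃ δI δQ₁ δQ₂ : ℝ,
    HasDerivAt (fun t : ℝ => action l R (fun r => A₁ r + t * φ₁ r) (fun r => A₂ r + t * φ₂ r))
      δI 0 ∧
    HasDerivAt (fun t : ℝ => flux R (fun r => A₁ r + t * φ₁ r)) δQ₁ 0 ∧
    HasDerivAt (fun t : ℝ => flux R (fun r => A₂ r + t * φ₂ r)) δQ₂ 0 ∧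
    δI = μ₁ * δQ₁ + μ₂ * δQ₂

end Vortex

end

/-!
With `n = |l|`, completing the square gives `A'² + n² A²/r² = (A' - n A/r)² + n (A²)'/r`, and the
last term integrates to zero against `r dr` because `A` vanishes at `0` and `R`. Hence
`A ↦ g = A' - n A/r` is an isometry from the finite-energy functions, with norm
`∫ (A'² + n² A²/r²) r dr`, into `L²((0, R), r dr)`, with left inverse
`A(r) = -rⁿ ∫_r^R g(s) s⁻ⁿ ds` (`radialPrimitive`). Using `n` for `A₁` and `2n` for `A₂`, the action
becomes `½‖g₁‖² + ¼‖g₂‖² - ∫ A₁² A₂ r dr` (`action_eq_hilbertAction`). Evaluation `g ↦ A(r)` is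
bounded uniformly in `r` (`isBoundedEvaluation_radialEval`), so that on the constraint set the cubic
term is at most linear in `‖g₂‖` and the action is coercive, whatever the size of `Q₁`.

The image of the admissible class is not closed in `L²`, since a limit may fail to be absolutely
continuous up to `r = 0`. One therefore minimizes over all of `L² × L²`, where a weakly convergent
subsequence of a minimizing sequence converges pointwise after evaluation, masses and cubic term
converge by dominated convergence, and norms are weakly lower semicontinuous
(`exists_isHilbertMinimizer`). By homogeneity the minimizer satisfies
`⟪g₁, k⟫ = ∫ F₁ · eval k`, `⟪g₂, k⟫ = ∫ F₂ · eval k` with `F₁ = 2 A₂ A₁ + Λ₁ A₁` and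
`F₂ = 2 A₁² + Λ₂ A₂` (`IsHilbertMinimizer.exists_multiplier₁`,
`IsHilbertMinimizer.exists_multiplier₂`). Fubini turns this into the explicit formula
`g(s) = -s^(-n-1) ∫_0^s r^(n+1) F(r) dr`, which makes `A` a classical solution of
`A'' + A'/r - n² A/r² = -F` and Lipschitz on `[0, R]`, hence admissible
(`isClassicalSolution_of_inner_eq`).

Absolute values do not increase the action (`action_abs_le`), so that `(|A₁|, |A₂|)` is a minimizer
too and is again a classical solution. A zero of `A₁ ≥ 0` would be a double zero of a solution of a
linear equation, forcing `A₁ = 0`; at a zero of `A₂ ≥ 0` the equation would give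
`A₂'' = -2 A₁² < 0` at a minimum. The multipliers are `κ = -Λ₁/2` and `2κ + β = -Λ₂/4`.
-/

noncomputable section

namespace Vortex

open Filter Topology
open scoped InnerProductSpace

/-! ### Euler–Lagrange equations for an action in evaluation form -/

section Abstract

variable {X : Type*} [MeasurableSpace X] {μ : Measure X}

lemma memLp_top_mul {u v : X → ℝ} (hu : MemLp u ⊤ μ) (hv : MemLp v ⊤ μ) :
    MemLp (fun x => u x * v x) ⊤ μ := hv.mul hu

lemma integral_cubic_expansion [IsFiniteMeasure μ] {u₁ u₂ φ₁ φ₂ : X → ℝ} (hu₁ : MemLp u₁ ⊤ μ)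
    (hu₂ : MemLp u₂ ⊤ μ) (hφ₁ : MemLp φ₁ ⊤ μ) (hφ₂ : MemLp φ₂ ⊤ μ) (t : ℝ) :
    ∫ x, (u₁ x + t * φ₁ x) ^ 2 * (u₂ x + t * φ₂ x) ∂μ
      = ∫ x, u₁ x ^ 2 * u₂ x ∂μ
        + t * (∫ x, 2 * u₂ x * u₁ x * φ₁ x ∂μ + ∫ x, u₁ x ^ 2 * φ₂ x ∂μ)
        + t ^ 2 * (∫ x, φ₁ x ^ 2 * u₂ x ∂μ + ∫ x, 2 * u₁ x * φ₁ x * φ₂ x ∂μ)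
        + t ^ 3 * ∫ x, φ₁ x ^ 2 * φ₂ x ∂μ := by
  have key : ∀ {a b c : X → ℝ}, MemLp a ⊤ μ → MemLp b ⊤ μ → MemLp c ⊤ μ →
      Integrable (fun x => a x * b x * c x) μ := fun ha hb hc =>
    (memLp_top_mul (memLp_top_mul ha hb) hc).integrable le_top
  have h1 := key hu₁ hu₁ hu₂
  have h2 := key hu₂ hu₁ hφ₁
  have h3 := key hu₁ hu₁ hφ₂
  have h4 := key hφ₁ hφ₁ hu₂
  have h5 := key hu₁ hφ₁ hφ₂
  have h6 := key hφ₁ hφ₁ hφ₂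
  have e2 : ∫ x, 2 * u₂ x * u₁ x * φ₁ x ∂μ = 2 * ∫ x, u₂ x * u₁ x * φ₁ x ∂μ := by
    rw [← integral_const_mul]; simp only [mul_assoc]
  have e5 : ∫ x, 2 * u₁ x * φ₁ x * φ₂ x ∂μ = 2 * ∫ x, u₁ x * φ₁ x * φ₂ x ∂μ := by
    rw [← integral_const_mul]; simp only [mul_assoc]
  rw [e2, e5]
  simp only [sq, ← integral_const_mul, mul_add]
  rw [← integral_add (h2.const_mul 2 |>.const_mul t) (h3.const_mul t),
    ← integral_add (h4.const_mul (t * t)) (h5.const_mul 2 |>.const_mul (t * t)),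
    ← integral_add h1, ← integral_add, ← integral_add]
  · exact integral_congr_ae (ae_of_all _ fun x => by ring)
  all_goals fun_prop (disch := assumption)

variable {H : Type*} [NormedAddCommGroup H] [InnerProductSpace ℝ H]

/-- A family of continuous linear functionals on `H`, indexed by a measure space `X`, which is
uniformly bounded and weakly measurable. It turns each `g : H` into a bounded measurable function
`x ↦ E x g` on `X`. -/
structure IsBoundedEvaluation (μ : Measure X) (E : X → StrongDual ℝ H) : Prop where
  bound : ∃ C, ∀ x, ‖E x‖ ≤ C
  aestronglyMeasurable : ∀ g, AEStronglyMeasurable (fun x => E x g) μ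

lemma IsBoundedEvaluation.memLp {E : X → StrongDual ℝ H} (hE : IsBoundedEvaluation μ E) (g : H) :
    MemLp (fun x => E x g) ⊤ μ := by
  obtain ⟨C, hC⟩ := hE.bound
  refine memLp_top_of_bound (hE.aestronglyMeasurable g) (C * ‖g‖) (ae_of_all _ fun x => ?_)
  exact (E x).le_of_opNorm_le (hC x) g

/-- The mass `∫ u² dμ` of the function `u = E · g`. -/
def mass (μ : Measure X) (E : X → StrongDual ℝ H) (g : H) : ℝ := ∫ x, E x g ^ 2 ∂μ

/-- The action written in terms of the Hilbert space variables `g₁, g₂`, where `uᵢ = Eᵢ · gᵢ`: the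
quadratic part is diagonal and the interaction term is `∫ u₁² u₂ dμ`. -/
def hilbertAction (μ : Measure X) (E₁ E₂ : X → StrongDual ℝ H) (g₁ g₂ : H) : ℝ :=
  (1 / 2) * ‖g₁‖ ^ 2 + (1 / 4) * ‖g₂‖ ^ 2 - ∫ x, E₁ x g₁ ^ 2 * E₂ x g₂ ∂μ

/-- `(g₁, g₂)` minimizes `hilbertAction` among the pairs with masses `q₁, q₂`. -/
structure IsHilbertMinimizer (μ : Measure X) (E₁ E₂ : X → StrongDual ℝ H) (q₁ q₂ : ℝ)
    (g₁ g₂ : H) : Prop where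
  mass₁ : mass μ E₁ g₁ = q₁
  mass₂ : mass μ E₂ g₂ = q₂
  minimal : ∀ k₁ k₂ : H, mass μ E₁ k₁ = q₁ → mass μ E₂ k₂ = q₂ →
    hilbertAction μ E₁ E₂ g₁ g₂ ≤ hilbertAction μ E₁ E₂ k₁ k₂

lemma mass_smul (E : X → StrongDual ℝ H) (c : ℝ) (g : H) :
    mass μ E (c • g) = c ^ 2 * mass μ E g := by
  simp only [mass, map_smul, smul_eq_mul, mul_pow, integral_const_mul]

lemma mass_nonneg (E : X → StrongDual ℝ H) (g : H) : 0 ≤ mass μ E g :=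
  integral_nonneg fun _ => sq_nonneg _

lemma IsBoundedEvaluation.ae_eq_zero [IsFiniteMeasure μ] {E : X → StrongDual ℝ H}
    (hE : IsBoundedEvaluation μ E) {g : H} (hg : mass μ E g = 0) : ∀ᵐ x ∂μ, E x g = 0 := by
  have hi : Integrable (fun x => E x g ^ 2) μ := by
    simpa only [sq] using (memLp_top_mul (hE.memLp g) (hE.memLp g)).integrable le_top
  filter_upwards [(integral_eq_zero_iff_of_nonneg (fun _ => sq_nonneg _) hi).1 hg] with x hx
  exact pow_eq_zero_iff two_ne_zero |>.1 hx

lemma exists_smul_mass_eq {E : X → StrongDual ℝ H} {g : H} (hg : mass μ E g ≠ 0) {q : ℝ}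
    (hq : 0 < q) : ∃ c : ℝ, 0 < c ∧ c ^ 2 = q / mass μ E g ∧ mass μ E (c • g) = q := by
  have hpos : 0 < mass μ E g := (mass_nonneg E g).lt_of_ne' hg
  have hc : √(q / mass μ E g) ^ 2 = q / mass μ E g := Real.sq_sqrt (by positivity)
  refine ⟨√(q / mass μ E g), by positivity, hc, ?_⟩
  rw [mass_smul, hc]; field_simp

lemma mass_add_smul [IsFiniteMeasure μ] {E : X → StrongDual ℝ H} (hE : IsBoundedEvaluation μ E)
    (g k : H) (t : ℝ) :
    mass μ E (g + t • k) = mass μ E g + t * (2 * ∫ x, E x g * E x k ∂μ) + t ^ 2 * mass μ E k := by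
  have := integral_cubic_expansion (hE.memLp g) (memLp_top_const (1 : ℝ)) (hE.memLp k)
    (memLp_top_const (0 : ℝ)) t
  simp only [mul_zero, add_zero, mul_one, integral_zero, mul_assoc, integral_const_mul]
    at this
  simpa [mass] using this

lemma hilbertAction_add_smul [IsFiniteMeasure μ] {E₁ E₂ : X → StrongDual ℝ H}
    (h₁ : IsBoundedEvaluation μ E₁) (h₂ : IsBoundedEvaluation μ E₂) (g₁ g₂ k₁ k₂ : H) (t : ℝ) :
    hilbertAction μ E₁ E₂ (g₁ + t • k₁) (g₂ + t • k₂) = hilbertAction μ E₁ E₂ g₁ g₂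
      + t * (⟪g₁, k₁⟫_ℝ - ∫ x, 2 * E₂ x g₂ * E₁ x g₁ * E₁ x k₁ ∂μ
          + ((1 / 2) * ⟪g₂, k₂⟫_ℝ - ∫ x, E₁ x g₁ ^ 2 * E₂ x k₂ ∂μ))
      + t ^ 2 * ((1 / 2) * ‖k₁‖ ^ 2 + (1 / 4) * ‖k₂‖ ^ 2 - (∫ x, E₁ x k₁ ^ 2 * E₂ x g₂ ∂μ
          + ∫ x, 2 * E₁ x g₁ * E₁ x k₁ * E₂ x k₂ ∂μ))
      - t ^ 3 * ∫ x, E₁ x k₁ ^ 2 * E₂ x k₂ ∂μ := by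
  have := integral_cubic_expansion (h₁.memLp g₁) (h₂.memLp g₂) (h₁.memLp k₁) (h₂.memLp k₂) t
  simp only [hilbertAction, map_add, map_smul, smul_eq_mul, this, norm_add_sq_real, inner_smul_right,
    norm_smul, mul_pow, Real.norm_eq_abs, sq_abs]
  ring

/-- A real polynomial in `t` has its linear coefficient as derivative at `0`. -/
lemma hasDerivAt_cubic (a b c d : ℝ) :
    HasDerivAt (fun t : ℝ => a + t * b + t ^ 2 * c - t ^ 3 * d) b 0 := by
  have h := ((((hasDerivAt_id (0 : ℝ)).mul_const b).const_add a).add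
    (((hasDerivAt_id (0 : ℝ)).pow 2).mul_const c)).sub (((hasDerivAt_id (0 : ℝ)).pow 3).mul_const d)
  simpa using! h

/-- The Euler–Lagrange equation in the first variable. With the second variable fixed, both the
action (up to a constant) and the mass are quadratic forms, so by homogeneity their difference, for
a suitable multiplier, is nonnegative everywhere and vanishes at the minimizer. -/
lemma IsHilbertMinimizer.exists_multiplier₁ [IsFiniteMeasure μ] {E₁ E₂ : X → StrongDual ℝ H}
    (h₁ : IsBoundedEvaluation μ E₁) (h₂ : IsBoundedEvaluation μ E₂) {q₁ q₂ : ℝ} {g₁ g₂ : H}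
    (hq₁ : 0 < q₁) (hg : IsHilbertMinimizer μ E₁ E₂ q₁ q₂ g₁ g₂) :
    ∃ Λ : ℝ, ∀ k, ⟪g₁, k⟫_ℝ
      = ∫ x, 2 * E₂ x g₂ * E₁ x g₁ * E₁ x k ∂μ + Λ * ∫ x, E₁ x g₁ * E₁ x k ∂μ := by
  set P : H → ℝ := fun g => (1 / 2) * ‖g‖ ^ 2 - ∫ x, E₁ x g ^ 2 * E₂ x g₂ ∂μ with hP
  have hPJ : ∀ g, hilbertAction μ E₁ E₂ g g₂ = P g + (1 / 4) * ‖g₂‖ ^ 2 := fun g => by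
    simp only [hilbertAction, hP]; ring
  have hle : ∀ g, 0 ≤ P g - P g₁ / q₁ * mass μ E₁ g := by
    intro g
    by_cases h0 : mass μ E₁ g = 0
    · have : ∫ x, E₁ x g ^ 2 * E₂ x g₂ ∂μ = 0 := by
        rw [← integral_zero X ℝ (μ := μ)]
        refine integral_congr_ae ?_
        filter_upwards [h₁.ae_eq_zero h0] with x hx
        simp [hx]
      rw [h0, hP]; simp only [this]; nlinarith [sq_nonneg ‖g‖]
    · obtain ⟨c, hc, hc2, hcm⟩ := exists_smul_mass_eq h0 hq₁
      have hm := hg.minimal (c • g) g₂ hcm hg.mass₂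
      have hPc : P (c • g) = c ^ 2 * P g := by
        simp only [hP, map_smul, smul_eq_mul, mul_pow, norm_smul, Real.norm_eq_abs, sq_abs,
          mul_assoc, integral_const_mul]
        ring
      rw [hPJ, hPJ, hPc, hc2] at hm
      have hpos : 0 < mass μ E₁ g := (mass_nonneg E₁ g).lt_of_ne' h0
      have : P g₁ ≤ q₁ / mass μ E₁ g * P g := by linarith
      rw [div_mul_eq_mul_div, le_div_iff₀ hpos] at this
      rw [div_mul_eq_mul_div, sub_nonneg, div_le_iff₀ hq₁]
      linarith
  refine ⟨2 * (P g₁ / q₁), fun k => ?_⟩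
  have hexp : ∀ t : ℝ, P (g₁ + t • k) - P g₁ / q₁ * mass μ E₁ (g₁ + t • k) =
      0 + t * (⟪g₁, k⟫_ℝ - ∫ x, 2 * E₂ x g₂ * E₁ x g₁ * E₁ x k ∂μ
        - P g₁ / q₁ * (2 * ∫ x, E₁ x g₁ * E₁ x k ∂μ))
      + t ^ 2 * ((1 / 2) * ‖k‖ ^ 2 - ∫ x, E₁ x k ^ 2 * E₂ x g₂ ∂μ - P g₁ / q₁ * mass μ E₁ k)
      - t ^ 3 * 0 := by
    intro t
    have hA := hilbertAction_add_smul h₁ h₂ g₁ g₂ k 0 t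
    simp only [smul_zero, add_zero, hPJ, map_zero, mul_zero, inner_zero_right, integral_zero,
      norm_zero, sub_zero] at hA
    have : P g₁ / q₁ * q₁ = P g₁ := by field_simp
    rw [mass_add_smul h₁, hg.mass₁]
    linear_combination hA - this
  have hd := (hasDerivAt_cubic 0 _ _ 0).congr_of_eventuallyEq (Eventually.of_forall hexp)
  have hmin : IsLocalMin (fun t : ℝ => P (g₁ + t • k) - P g₁ / q₁ * mass μ E₁ (g₁ + t • k)) 0 := by
    refine Eventually.of_forall fun t => ?_
    refine le_trans (le_of_eq ?_) (hle _)
    simpa using hexp 0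
  have := hmin.hasDerivAt_eq_zero hd
  linarith

/-- The Euler–Lagrange equation in the second variable. The interaction term is linear in it, so
after rescaling to the constraint the minimality reads `F (g₂ + t k) ≥ 0 = F g₂`, where `F` has the
square root of the mass as the coefficient of the interaction term. -/
lemma IsHilbertMinimizer.exists_multiplier₂ [IsFiniteMeasure μ] {E₁ E₂ : X → StrongDual ℝ H}
    (h₁ : IsBoundedEvaluation μ E₁) (h₂ : IsBoundedEvaluation μ E₂) {q₁ q₂ : ℝ} {g₁ g₂ : H}
    (hq₂ : 0 < q₂) (hg : IsHilbertMinimizer μ E₁ E₂ q₁ q₂ g₁ g₂) :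
    ∃ Λ : ℝ, ∀ k, ⟪g₂, k⟫_ℝ
      = 2 * ∫ x, E₁ x g₁ ^ 2 * E₂ x k ∂μ + Λ * ∫ x, E₂ x g₂ * E₂ x k ∂μ := by
  set L : H → ℝ := fun g => ∫ x, E₁ x g₁ ^ 2 * E₂ x g ∂μ with hL
  set m : ℝ := (1 / 4) * ‖g₂‖ ^ 2 - L g₂ with hm
  have hJ : ∀ g, hilbertAction μ E₁ E₂ g₁ g
      = (1 / 2) * ‖g₁‖ ^ 2 + ((1 / 4) * ‖g‖ ^ 2 - L g) := fun g => by
    simp only [hilbertAction, hL]; ring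
  have hint : ∀ g, Integrable (fun x => E₁ x g₁ ^ 2 * E₂ x g) μ := fun g => by
    simpa only [sq] using (memLp_top_mul (memLp_top_mul (h₁.memLp g₁) (h₁.memLp g₁))
      (h₂.memLp g)).integrable le_top
  have hLsmul : ∀ (c : ℝ) g, L (c • g) = c * L g := fun c g => by
    simp only [hL, map_smul, smul_eq_mul, ← integral_const_mul]
    exact integral_congr_ae (ae_of_all _ fun x => by ring)
  have hLadd : ∀ g k, L (g + k) = L g + L k := fun g k => by
    simp only [hL, map_add, mul_add]
    exact integral_add (hint g) (hint k)
  have hle : ∀ g, 0 ≤ (1 / 4) * ‖g‖ ^ 2 - L g * √(mass μ E₂ g / q₂) - m * (mass μ E₂ g / q₂) := by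
    intro g
    by_cases h0 : mass μ E₂ g = 0
    · rw [h0]; simp
    · obtain ⟨c, hc, hc2, hcm⟩ := exists_smul_mass_eq h0 hq₂
      have hmin := hg.minimal g₁ (c • g) hg.mass₁ hcm
      have hpos : 0 < mass μ E₂ g := (mass_nonneg E₂ g).lt_of_ne' h0
      rw [hJ, hJ, hLsmul, norm_smul, mul_pow, Real.norm_eq_abs, sq_abs] at hmin
      have e1 : mass μ E₂ g / q₂ = (c⁻¹) ^ 2 := by rw [inv_pow, hc2, inv_div]
      rw [e1, Real.sqrt_sq (by positivity)]
      have : m * (c⁻¹) ^ 2 ≤ (1 / 4 * (c ^ 2 * ‖g‖ ^ 2) - c * L g) * (c⁻¹) ^ 2 := by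
        gcongr; linarith
      have e2 : (1 / 4 * (c ^ 2 * ‖g‖ ^ 2) - c * L g) * (c⁻¹) ^ 2
          = 1 / 4 * ‖g‖ ^ 2 - L g * c⁻¹ := by field_simp
      linarith
  refine ⟨2 * ((L g₂ + 2 * m) / q₂), fun k => ?_⟩
  set b : ℝ := ∫ x, E₂ x g₂ * E₂ x k ∂μ
  set f : ℝ → ℝ := fun t => (1 / 4) * ‖g₂ + t • k‖ ^ 2
    - L (g₂ + t • k) * √(mass μ E₂ (g₂ + t • k) / q₂) - m * (mass μ E₂ (g₂ + t • k) / q₂) with hf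
  have hN : HasDerivAt (fun t : ℝ => mass μ E₂ (g₂ + t • k) / q₂) (2 * b / q₂) 0 := by
    have := (hasDerivAt_cubic (mass μ E₂ g₂) (2 * b) (mass μ E₂ k) 0).div_const q₂
    simpa only [mass_add_smul h₂, mul_zero, sub_zero] using this
  have hN0 : mass μ E₂ (g₂ + (0 : ℝ) • k) / q₂ = 1 := by
    rw [zero_smul, add_zero, hg.mass₂, div_self hq₂.ne']
  have hS := hN.sqrt (by rw [hN0]; exact one_ne_zero)
  have hLd : HasDerivAt (fun t : ℝ => L (g₂ + t • k)) (L k) 0 := by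
    have := hasDerivAt_cubic (L g₂) (L k) 0 0
    simpa only [hLadd, hLsmul, mul_zero, sub_zero, add_zero] using this
  have hnd : HasDerivAt (fun t : ℝ => (1 / 4) * ‖g₂ + t • k‖ ^ 2) ((1 / 2) * ⟪g₂, k⟫_ℝ) 0 := by
    have := hasDerivAt_cubic ((1 / 4) * ‖g₂‖ ^ 2) ((1 / 2) * ⟪g₂, k⟫_ℝ) ((1 / 4) * ‖k‖ ^ 2) 0
    refine this.congr_of_eventuallyEq (Eventually.of_forall fun t => ?_)
    simp only [norm_add_sq_real, inner_smul_right, norm_smul, mul_pow, Real.norm_eq_abs, sq_abs]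
    ring
  have hd := (hnd.sub (hLd.mul hS)).sub (hN.const_mul m)
  have hmin : IsLocalMin f 0 := by
    refine Eventually.of_forall fun t => ?_
    refine le_trans (le_of_eq ?_) (hle _)
    simp only [hf, zero_smul, add_zero, hm]
    rw [hg.mass₂, div_self hq₂.ne']
    simp
  have h0 := hmin.hasDerivAt_eq_zero hd
  rw [hN0, Real.sqrt_one, zero_smul, add_zero] at h0
  change _ = 2 * L k + _
  field_simp at h0 ⊢
  linarith

lemma IsBoundedEvaluation.exists_abs_le {E : X → StrongDual ℝ H} (hE : IsBoundedEvaluation μ E) :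
    ∃ C, 0 ≤ C ∧ ∀ x g, |E x g| ≤ C * ‖g‖ := by
  obtain ⟨C, hC⟩ := hE.bound
  exact ⟨max C 0, le_max_right _ _, fun x g =>
    (E x).le_of_opNorm_le ((hC x).trans (le_max_left _ _)) g⟩

/-- Along weakly convergent sequences, a bounded continuous expression in `E₁ x g₁` and `E₂ x g₂`
has convergent integrals. -/
lemma tendsto_integral_of_weak [IsFiniteMeasure μ] {E₁ E₂ : X → StrongDual ℝ H}
    (h₁ : IsBoundedEvaluation μ E₁) (h₂ : IsBoundedEvaluation μ E₂) {g₁ g₂ : ℕ → H} {C : ℝ}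
    (hg₁ : ∀ n, ‖g₁ n‖ ≤ C) (hg₂ : ∀ n, ‖g₂ n‖ ≤ C) {a₁ a₂ : H}
    (hl₁ : ∀ ℓ : StrongDual ℝ H, Tendsto (fun n => ℓ (g₁ n)) atTop (𝓝 (ℓ a₁)))
    (hl₂ : ∀ ℓ : StrongDual ℝ H, Tendsto (fun n => ℓ (g₂ n)) atTop (𝓝 (ℓ a₂))) :
    Tendsto (fun n => ∫ x, E₁ x (g₁ n) ^ 2 * E₂ x (g₂ n) ∂μ) atTop
      (𝓝 (∫ x, E₁ x a₁ ^ 2 * E₂ x a₂ ∂μ)) := by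
  obtain ⟨C₁, hC₁, hb₁⟩ := h₁.exists_abs_le
  obtain ⟨C₂, hC₂, hb₂⟩ := h₂.exists_abs_le
  refine tendsto_integral_of_dominated_convergence (fun _ => (C₁ * C) ^ 2 * (C₂ * C))
    (fun n => ((h₁.aestronglyMeasurable _).pow 2).mul (h₂.aestronglyMeasurable _))
    (integrable_const _) (fun n => ae_of_all _ fun x => ?_)
    (ae_of_all _ fun x => ((hl₁ (E₁ x)).pow 2).mul (hl₂ (E₂ x)))
  have hC : 0 ≤ C := (norm_nonneg _).trans (hg₁ 0)
  rw [norm_mul, norm_pow, Real.norm_eq_abs, Real.norm_eq_abs]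
  gcongr
  · exact (hb₁ x _).trans (by gcongr; exact hg₁ n)
  · exact (hb₂ x _).trans (by gcongr; exact hg₂ n)

lemma tendsto_mass_of_weak [IsFiniteMeasure μ] {E : X → StrongDual ℝ H}
    (hE : IsBoundedEvaluation μ E) {g : ℕ → H} {C : ℝ} (hg : ∀ n, ‖g n‖ ≤ C) {a : H}
    (hl : ∀ ℓ : StrongDual ℝ H, Tendsto (fun n => ℓ (g n)) atTop (𝓝 (ℓ a))) :
    Tendsto (fun n => mass μ E (g n)) atTop (𝓝 (mass μ E a)) := by
  obtain ⟨C₁, hC₁, hb₁⟩ := hE.exists_abs_le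
  refine tendsto_integral_of_dominated_convergence (fun _ => (C₁ * C) ^ 2)
    (fun n => (hE.aestronglyMeasurable _).pow 2)
    (integrable_const _) (fun n => ae_of_all _ fun x => ?_)
    (ae_of_all _ fun x => (hl (E x)).pow 2)
  rw [norm_pow, Real.norm_eq_abs]
  gcongr
  exact (hb₁ x _).trans (by gcongr; exact hg n)

/-- Coercivity: on the constraint set the interaction term grows only linearly in `‖g₂‖`. -/
lemma exists_coercivity [IsFiniteMeasure μ] {E₁ E₂ : X → StrongDual ℝ H}
    (h₁ : IsBoundedEvaluation μ E₁) (h₂ : IsBoundedEvaluation μ E₂) (q₁ : ℝ) :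
    ∃ D, ∀ g₁ g₂ : H, mass μ E₁ g₁ = q₁ →
      (1 / 2) * ‖g₁‖ ^ 2 + (1 / 8) * ‖g₂‖ ^ 2 - D ≤ hilbertAction μ E₁ E₂ g₁ g₂ := by
  obtain ⟨C, hC, hb⟩ := h₂.exists_abs_le
  refine ⟨2 * (C * q₁) ^ 2, fun g₁ g₂ hm => ?_⟩
  have hi : Integrable (fun x => E₁ x g₁ ^ 2) μ := by
    simpa only [sq] using (memLp_top_mul (h₁.memLp g₁) (h₁.memLp g₁)).integrable le_top
  have hi' : Integrable (fun x => E₁ x g₁ ^ 2 * E₂ x g₂) μ := by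
    simpa only [sq] using (memLp_top_mul (memLp_top_mul (h₁.memLp g₁) (h₁.memLp g₁))
      (h₂.memLp g₂)).integrable le_top
  have : ∫ x, E₁ x g₁ ^ 2 * E₂ x g₂ ∂μ ≤ q₁ * (C * ‖g₂‖) := by
    rw [← hm, mass, ← integral_mul_const]
    refine integral_mono hi' (hi.mul_const _) fun x => ?_
    exact mul_le_mul_of_nonneg_left ((le_abs_self _).trans (hb x g₂)) (sq_nonneg _)
  simp only [hilbertAction]
  nlinarith [sq_nonneg (‖g₂‖ - 4 * (C * q₁))]

end Abstract

/-! ### Existence of minimizers by the direct method -/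

section Existence

variable {X : Type*} [MeasurableSpace X] {μ : Measure X}
variable {H : Type*} [NormedAddCommGroup H] [InnerProductSpace ℝ H] [CompleteSpace H]
  [TopologicalSpace.SeparableSpace H]

/-- A bounded sequence in a separable Hilbert space has a weakly convergent subsequence. -/
lemma exists_subseq_tendsto_weakly {g : ℕ → H} {C : ℝ} (hg : ∀ n, ‖g n‖ ≤ C) :
    ∃ (a : H) (φ : ℕ → ℕ), StrictMono φ ∧
      ∀ ℓ : StrongDual ℝ H, Tendsto (fun n => ℓ (g (φ n))) atTop (𝓝 (ℓ a)) := by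
  have hmem : ∀ n, StrongDual.toWeakDual (InnerProductSpace.toDual ℝ H (g n)) ∈
      WeakDual.toStrongDual ⁻¹' Metric.closedBall (0 : StrongDual ℝ H) C := fun n => by
    simpa using hg n
  obtain ⟨w, -, φ, hφ, hlim⟩ := WeakDual.isSeqCompact_closedBall ℝ H 0 C hmem
  refine ⟨(InnerProductSpace.toDual ℝ H).symm (WeakDual.toStrongDual w), φ, hφ, fun ℓ => ?_⟩
  obtain ⟨k, rfl⟩ := (InnerProductSpace.toDual ℝ H).surjective ℓ
  have := (WeakDual.eval_continuous k).tendsto w |>.comp hlim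
  rw [InnerProductSpace.toDual_apply_apply, real_inner_comm,
    InnerProductSpace.toDual_symm_apply]
  refine this.congr fun n => ?_
  rw [InnerProductSpace.toDual_apply_apply, real_inner_comm]
  rfl

/-- The direct method: a minimizing sequence is bounded, a subsequence converges weakly, masses and
interaction pass to the limit, and the squared norms are weakly lower semicontinuous. -/
theorem exists_isHilbertMinimizer [IsFiniteMeasure μ] {E₁ E₂ : X → StrongDual ℝ H}
    (h₁ : IsBoundedEvaluation μ E₁) (h₂ : IsBoundedEvaluation μ E₂) {q₁ q₂ : ℝ}
    (hne₁ : ∃ g, mass μ E₁ g = q₁) (hne₂ : ∃ g, mass μ E₂ g = q₂) :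
    ∃ g₁ g₂, IsHilbertMinimizer μ E₁ E₂ q₁ q₂ g₁ g₂ := by
  obtain ⟨D, hD⟩ := exists_coercivity h₁ h₂ q₁
  set S : Set ℝ := {y | ∃ g₁ g₂, mass μ E₁ g₁ = q₁ ∧ mass μ E₂ g₂ = q₂ ∧
    hilbertAction μ E₁ E₂ g₁ g₂ = y} with hS
  have hSne : S.Nonempty := by
    obtain ⟨g₁, hg₁⟩ := hne₁
    obtain ⟨g₂, hg₂⟩ := hne₂
    exact ⟨_, g₁, g₂, hg₁, hg₂, rfl⟩
  have hSb : BddBelow S := by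
    refine ⟨-D, ?_⟩
    rintro y ⟨g₁, g₂, hm, -, rfl⟩
    have := hD g₁ g₂ hm
    nlinarith [sq_nonneg ‖g₁‖, sq_nonneg ‖g₂‖]
  obtain ⟨y, hanti, hy, hyS⟩ := exists_seq_tendsto_sInf hSne hSb
  choose g₁ g₂ hm₁ hm₂ hJ using hyS
  obtain ⟨B, hB⟩ : ∃ B, 0 ≤ B ∧ ∀ n, ‖g₁ n‖ ≤ B ∧ ‖g₂ n‖ ≤ B := by
    have hyB : ∀ n, y n ≤ y 0 := fun n => hanti (Nat.zero_le n)
    have h0 : 0 ≤ y 0 + D := by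
      have := hD _ (g₂ 0) (hm₁ 0)
      rw [hJ] at this
      nlinarith [sq_nonneg ‖g₁ 0‖, sq_nonneg ‖g₂ 0‖]
    refine ⟨8 * (y 0 + D) + 1, by linarith, fun n => ?_⟩
    have := hD _ (g₂ n) (hm₁ n)
    rw [hJ] at this
    have := hyB n
    constructor
    · nlinarith [sq_nonneg (‖g₁ n‖ - 1), sq_nonneg ‖g₂ n‖]
    · nlinarith [sq_nonneg ‖g₁ n‖, sq_nonneg (‖g₂ n‖ - 1)]
  obtain ⟨hB0, hB⟩ := hB
  obtain ⟨a₁, φ, hφ, hl₁⟩ := exists_subseq_tendsto_weakly fun n => (hB n).1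
  obtain ⟨a₂, ψ, hψ, hl₂⟩ := exists_subseq_tendsto_weakly fun n => (hB (φ n)).2
  replace hl₁ := fun ℓ => (hl₁ ℓ).comp hψ.tendsto_atTop
  have hyθ : Tendsto (fun n => y (φ (ψ n))) atTop (𝓝 (sInf S)) :=
    hy.comp (hφ.tendsto_atTop.comp hψ.tendsto_atTop)
  have hM₁ := tendsto_mass_of_weak (g := fun n => g₁ (φ (ψ n))) h₁ (fun n => (hB _).1) hl₁
  have hM₂ := tendsto_mass_of_weak (g := fun n => g₂ (φ (ψ n))) h₂ (fun n => (hB _).2) hl₂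
  have hC := tendsto_integral_of_weak (g₁ := fun n => g₁ (φ (ψ n))) (g₂ := fun n => g₂ (φ (ψ n)))
    h₁ h₂ (fun n => (hB _).1) (fun n => (hB _).2) hl₁ hl₂
  simp only [hm₁] at hM₁
  simp only [hm₂] at hM₂
  have hle : hilbertAction μ E₁ E₂ a₁ a₂ ≤ sInf S := by
    have hin₁ := hl₁ (innerSL ℝ a₁)
    have hin₂ := hl₂ (innerSL ℝ a₂)
    simp only [innerSL_apply_apply, real_inner_self_eq_norm_sq, Function.comp_def] at hin₁ hin₂
    have hlow := ((hin₁.sub_const ((1 / 2) * ‖a₁‖ ^ 2)).add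
      ((hin₂.const_mul (1 / 2)).sub_const ((1 / 4) * ‖a₂‖ ^ 2))).sub hC
    have heq : ‖a₁‖ ^ 2 - 1 / 2 * ‖a₁‖ ^ 2 + (1 / 2 * ‖a₂‖ ^ 2 - 1 / 4 * ‖a₂‖ ^ 2)
        - ∫ x, E₁ x a₁ ^ 2 * E₂ x a₂ ∂μ = hilbertAction μ E₁ E₂ a₁ a₂ := by
      simp only [hilbertAction]; ring
    rw [heq] at hlow
    refine le_of_tendsto_of_tendsto' hlow hyθ fun n => ?_
    rw [← hJ, hilbertAction]
    -- weak lower semicontinuity: `‖g‖² ≥ 2⟪a, g⟫ - ‖a‖²`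
    have e₁ := norm_sub_sq_real a₁ (g₁ (φ (ψ n)))
    have e₂ := norm_sub_sq_real a₂ (g₂ (φ (ψ n)))
    nlinarith [sq_nonneg ‖a₁ - g₁ (φ (ψ n))‖, sq_nonneg ‖a₂ - g₂ (φ (ψ n))‖]
  refine ⟨a₁, a₂, tendsto_nhds_unique hM₁ tendsto_const_nhds,
    tendsto_nhds_unique hM₂ tendsto_const_nhds, fun k₁ k₂ hk₁ hk₂ => ?_⟩
  exact hle.trans (csInf_le hSb ⟨k₁, k₂, hk₁, hk₂, rfl⟩)

end Existence

/-! ### The space `L²(r dr)` and its evaluation functionals -/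

section Radial

/-- The measure `r dr` on the interval `(0, R)`. -/
def radialMeasure (R : ℝ) : Measure ℝ :=
  (volume.restrict (Ioo 0 R)).withDensity fun r => (r.toNNReal : ENNReal)

variable {R : ℝ}

lemma ae_radialMeasure_iff {p : ℝ → Prop} :
    (∀ᵐ r ∂radialMeasure R, p r) ↔ ∀ᵐ r ∂volume.restrict (Ioo 0 R), p r := by
  rw [radialMeasure, ae_withDensity_iff (by fun_prop)]
  refine eventually_congr ?_
  filter_upwards [ae_restrict_mem measurableSet_Ioo] with r hr
  simp [hr.1]

lemma ae_radialMeasure_mem : ∀ᵐ r ∂radialMeasure R, r ∈ Ioo 0 R :=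
  ae_radialMeasure_iff.2 (ae_restrict_mem measurableSet_Ioo)

lemma radialMeasure_absolutelyContinuous : radialMeasure R ≪ volume.restrict (Ioo 0 R) :=
  withDensity_absolutelyContinuous _ _

lemma restrict_absolutelyContinuous_radialMeasure :
    volume.restrict (Ioo 0 R) ≪ radialMeasure R :=
  Measure.AbsolutelyContinuous.mk fun s _ h => by
    have := measure_eq_zero_iff_ae_notMem.1 h
    exact measure_eq_zero_iff_ae_notMem.2 (ae_radialMeasure_iff.1 this)

lemma integrable_radialMeasure_iff {f : ℝ → ℝ} :
    Integrable f (radialMeasure R) ↔ IntegrableOn (fun r => f r * r) (Ioo 0 R) := by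
  rw [radialMeasure, integrable_withDensity_iff_integrable_coe_smul (by fun_prop)]
  refine integrable_congr ?_
  filter_upwards [ae_restrict_mem measurableSet_Ioo] with r hr
  simp [hr.1.le, mul_comm]

lemma integral_radialMeasure (f : ℝ → ℝ) :
    ∫ r, f r ∂radialMeasure R = ∫ r in Ioo 0 R, f r * r := by
  rw [radialMeasure, integral_withDensity_eq_integral_smul (by fun_prop)]
  refine integral_congr_ae ?_
  filter_upwards [ae_restrict_mem measurableSet_Ioo] with r hr
  simp [NNReal.smul_def, hr.1.le, mul_comm]

lemma intervalIntegral_eq_radialMeasure (hR : 0 < R) (f : ℝ → ℝ) :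
    ∫ r in (0 : ℝ)..R, f r * r = ∫ r, f r ∂radialMeasure R := by
  rw [integral_radialMeasure, intervalIntegral.integral_of_le hR.le, integral_Ioc_eq_integral_Ioo]

instance : IsFiniteMeasure (radialMeasure R) := by
  have : Integrable (fun _ : ℝ => (1 : ℝ)) (radialMeasure R) := by
    rw [integrable_radialMeasure_iff]
    exact ((by fun_prop : Continuous fun r : ℝ => 1 * r).continuousOn.integrableOn_Icc).mono_set
      Ioo_subset_Icc_self
  exact (integrable_const_iff_isFiniteMeasure one_ne_zero).1 this

lemma aestronglyMeasurable_radialMeasure {f : ℝ → ℝ} (hf : ContinuousOn f (Ioo 0 R)) :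
    AEStronglyMeasurable f (radialMeasure R) :=
  (hf.aestronglyMeasurable measurableSet_Ioo).mono_ac radialMeasure_absolutelyContinuous

/-- The Hilbert space `L²((0, R), r dr)`. -/
abbrev RadialL2 (R : ℝ) : Type := Lp ℝ 2 (radialMeasure R)

lemma norm_sq_radialL2 (g : RadialL2 R) : ‖g‖ ^ 2 = ∫ r, g r ^ 2 ∂radialMeasure R := by
  rw [← real_inner_self_eq_norm_sq, L2.inner_def]
  simp [sq]

lemma inner_radialL2 (g k : RadialL2 R) : ⟪g, k⟫_ℝ = ∫ r, g r * k r ∂radialMeasure R := by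
  rw [L2.inner_def]
  simp [mul_comm]

lemma intervalIntegrable_div_pow {g : ℝ → ℝ} (hg : MemLp g 2 (radialMeasure R)) (n : ℕ) {r : ℝ}
    (hr : r ∈ Ioo 0 R) : IntervalIntegrable (fun s => g s / s ^ n) volume r R := by
  have h1 : IntegrableOn (fun s => g s * s) (Ioo 0 R) :=
    integrable_radialMeasure_iff.1 (hg.integrable one_le_two)
  have h2 : IntervalIntegrable (fun s => g s * s) volume r R :=
    (intervalIntegrable_iff_integrableOn_Ioo_of_le hr.2.le).2 (h1.mono_set (Ioo_subset_Ioo_left hr.1.le))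
  have hne : ∀ s ∈ uIcc r R, s ≠ 0 := fun s hs => by
    rw [uIcc_of_le hr.2.le] at hs
    exact (hr.1.trans_le hs.1).ne'
  have h3 : ContinuousOn (fun s : ℝ => (s ^ (n + 1))⁻¹) (uIcc r R) :=
    ContinuousOn.inv₀ (by fun_prop) fun s hs => pow_ne_zero _ (hne s hs)
  refine (h2.mul_continuousOn h3).congr_ae ?_
  filter_upwards [ae_restrict_mem measurableSet_uIoc] with s hs
  have := hne s (uIoc_subset_uIcc hs)
  field_simp
  ring

/-- The solution `A` of `A' - n A / r = g` on `(0, R)` with `A(R) = 0`. -/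
def radialPrimitive (n : ℕ) (R : ℝ) (g : ℝ → ℝ) (r : ℝ) : ℝ :=
  -(r ^ n * ∫ s in r..R, g s / s ^ n)

lemma hasDerivAt_radialPrimitive {n : ℕ} {g : ℝ → ℝ} (hg : MemLp g 2 (radialMeasure R)) {r : ℝ}
    (hr : r ∈ Ioo 0 R) (hc : ContinuousOn g (Ioo 0 R)) :
    HasDerivAt (radialPrimitive n R g) (n * radialPrimitive n R g r / r + g r) r := by
  have hr0 : r ≠ 0 := hr.1.ne'
  have hcq : ContinuousOn (fun s => g s / s ^ n) (Ioo 0 R) :=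
    hc.div (by fun_prop) fun s hs => pow_ne_zero _ hs.1.ne'
  have h1 := intervalIntegral.integral_hasDerivAt_left (intervalIntegrable_div_pow hg n hr)
    (hcq.stronglyMeasurableAtFilter isOpen_Ioo r hr) (hcq.continuousAt (isOpen_Ioo.mem_nhds hr))
  have h2 := ((hasDerivAt_pow n r).mul h1).neg
  refine h2.congr_deriv ?_
  unfold radialPrimitive
  have : (n : ℝ) * r ^ (n - 1) = n * r ^ n / r := by
    rcases n with _ | n
    · simp
    · field_simp; simp [pow_succ]
  rw [this]
  field_simp
  ring

lemma continuousOn_radialPrimitive {n : ℕ} {g : ℝ → ℝ} (hg : MemLp g 2 (radialMeasure R)) :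
    ContinuousOn (radialPrimitive n R g) (Ioo 0 R) := by
  intro r hr
  have hr2 : r / 2 ∈ Ioo 0 R := ⟨by linarith [hr.1], by linarith [hr.1, hr.2]⟩
  have hint := intervalIntegrable_div_pow hg n hr2
  have hcont : ContinuousOn (fun x => ∫ s in x..R, g s / s ^ n) (uIcc (r / 2) R) := by
    have := (intervalIntegral.continuousOn_primitive_interval' hint.symm left_mem_uIcc).neg
    rw [uIcc_comm]
    refine this.congr fun x _ => ?_
    rw [intervalIntegral.integral_symm]; rfl
  have hnhds : uIcc (r / 2) R ∈ 𝓝 r := by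
    rw [uIcc_of_le hr2.2.le]
    exact Icc_mem_nhds (by linarith [hr.1]) hr.2
  exact ((((continuous_pow n).continuousAt).mul (hcont.continuousAt hnhds)).neg).continuousWithinAt

/-- The kernel of the evaluation `g ↦ radialPrimitive n R g r` with respect to `s ds`. -/
def evalKernel (n : ℕ) (R r : ℝ) : ℝ → ℝ :=
  (Ioo r R).indicator fun s => -(r ^ n / s ^ (n + 1))

lemma memLp_evalKernel (n : ℕ) {r : ℝ} (hr : r ∈ Ioo 0 R) :
    MemLp (evalKernel n R r) 2 (radialMeasure R) := by
  refine (memLp_top_of_bound (C := r ^ n / r ^ (n + 1)) ?_ (ae_of_all _ fun s => ?_)).mono_exponent le_top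
  · refine Measurable.aestronglyMeasurable ?_
    exact Measurable.indicator (by fun_prop) measurableSet_Ioo
  · have := hr.1
    unfold evalKernel
    by_cases hs : s ∈ Ioo r R
    · have h0 : 0 < s := hr.1.trans hs.1
      rw [indicator_of_mem hs, norm_neg, Real.norm_eq_abs, abs_of_nonneg (by positivity)]
      gcongr
      exact hs.1.le
    · rw [indicator_of_notMem hs, norm_zero]; positivity

lemma integral_evalKernel_mul (n : ℕ) {r : ℝ} (hr : r ∈ Ioo 0 R) (g : ℝ → ℝ) :
    ∫ s, evalKernel n R r s * g s ∂radialMeasure R = radialPrimitive n R g r := by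
  have h : ∀ s, evalKernel n R r s * g s * s
      = (Ioo r R).indicator (fun s => -(r ^ n * (g s / s ^ n))) s := fun s => by
    unfold evalKernel
    by_cases hs : s ∈ Ioo r R
    · have h0 : 0 < s := hr.1.trans hs.1
      rw [indicator_of_mem hs, indicator_of_mem hs]
      field_simp
      ring
    · rw [indicator_of_notMem hs, indicator_of_notMem hs]; simp
  rw [integral_radialMeasure]
  simp only [h]
  rw [setIntegral_indicator measurableSet_Ioo, inter_eq_self_of_subset_right
    (Ioo_subset_Ioo_left hr.1.le), radialPrimitive, intervalIntegral.integral_of_le hr.2.le,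
    integral_Ioc_eq_integral_Ioo, integral_neg, integral_const_mul]

/-- For `n ≥ 1` the evaluation kernels are bounded in `L²(s ds)`, uniformly in `r`. -/
lemma integral_evalKernel_sq_le {n : ℕ} (hn : n ≠ 0) {r : ℝ} (hr : r ∈ Ioo 0 R) :
    ∫ s, evalKernel n R r s ^ 2 ∂radialMeasure R ≤ 1 := by
  have hr0 := hr.1
  have hR0 : 0 < R := hr.1.trans hr.2
  simp only [sq]
  rw [integral_evalKernel_mul n hr, radialPrimitive, ← mul_neg, ← intervalIntegral.integral_neg]
  have hne : ∀ s ∈ uIcc r R, s ≠ 0 := fun s hs => by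
    rw [uIcc_of_le hr.2.le] at hs
    exact (hr.1.trans_le hs.1).ne'
  have hder : ∀ s ∈ uIcc r R, HasDerivAt (fun s : ℝ => -(s⁻¹)) (1 / s ^ 2) s := fun s hs => by
    simpa [neg_div] using! (hasDerivAt_inv (hne s hs)).neg
  have hcont : ContinuousOn (fun s : ℝ => 1 / s ^ 2) (uIcc r R) :=
    continuousOn_const.div (by fun_prop) fun s hs => pow_ne_zero _ (hne s hs)
  have hI : ∫ s in r..R, 1 / s ^ 2 = r⁻¹ - R⁻¹ := by
    rw [intervalIntegral.integral_eq_sub_of_hasDerivAt hder hcont.intervalIntegrable]; ring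
  have hle : ∫ s in r..R, -(evalKernel n R r s / s ^ n) ≤ ∫ s in r..R, (r / r ^ n) * (1 / s ^ 2) := by
    refine intervalIntegral.integral_mono_on_of_le_Ioo hr.2.le ?_ ?_ fun s hs => ?_
    · exact (intervalIntegrable_div_pow (memLp_evalKernel n hr) n hr).neg
    · exact (hcont.intervalIntegrable).const_mul _
    · have hs0 : 0 < s := hr.1.trans hs.1
      rw [evalKernel, indicator_of_mem hs, neg_div, neg_neg]
      obtain ⟨m, rfl⟩ := Nat.exists_eq_succ_of_ne_zero hn
      have h1 : (r / s) ^ (m + 1) * (r / s) ^ m ≤ 1 := by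
        have : r / s ≤ 1 := (div_le_one hs0).2 hs.1.le
        have h0 : 0 ≤ r / s := by positivity
        exact mul_le_one₀ (pow_le_one₀ h0 this) (by positivity) (pow_le_one₀ h0 this)
      have e : r ^ (m + 1) / s ^ (m + 1 + 1) / s ^ (m + 1)
          = (r / r ^ (m + 1) * (1 / s ^ 2)) * ((r / s) ^ (m + 1) * (r / s) ^ m) := by
        rw [div_pow, div_pow]
        field_simp
        ring
      change r ^ (m + 1) / s ^ (m + 1 + 1) / s ^ (m + 1) ≤ r / r ^ (m + 1) * (1 / s ^ 2)
      rw [e]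
      exact mul_le_of_le_one_right (by positivity) h1
  calc r ^ n * ∫ s in r..R, -(evalKernel n R r s / s ^ n)
      ≤ r ^ n * ∫ s in r..R, (r / r ^ n) * (1 / s ^ 2) := by gcongr
    _ = 1 - r / R := by
      rw [intervalIntegral.integral_const_mul, hI]; field_simp
    _ ≤ 1 := by linarith [show 0 ≤ r / R by positivity]

/-- The value at `r` of `radialPrimitive n R g`, as a continuous linear functional of `g`; it is
zero for `r ∉ (0, R)`, in accordance with the boundary values. -/
def radialEval (n : ℕ) (R r : ℝ) : StrongDual ℝ (RadialL2 R) :=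
  open Classical in
  if hr : r ∈ Ioo 0 R then innerSL ℝ ((memLp_evalKernel n hr).toLp) else 0

lemma radialEval_apply (n : ℕ) {r : ℝ} (hr : r ∈ Ioo 0 R) (g : RadialL2 R) :
    radialEval n R r g = radialPrimitive n R g r := by
  rw [radialEval, dif_pos hr, innerSL_apply_apply, inner_radialL2, ← integral_evalKernel_mul n hr]
  refine integral_congr_ae ?_
  filter_upwards [(memLp_evalKernel n hr).coeFn_toLp] with s hs
  rw [hs]

lemma radialEval_of_notMem (n : ℕ) {r : ℝ} (hr : r ∉ Ioo 0 R) (g : RadialL2 R) :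
    radialEval n R r g = 0 := by
  rw [radialEval, dif_neg hr]; rfl

lemma continuousOn_radialEval (n : ℕ) (g : RadialL2 R) :
    ContinuousOn (fun r => radialEval n R r g) (Ioo 0 R) :=
  (continuousOn_radialPrimitive (Lp.memLp g)).congr fun _ hr => radialEval_apply n hr g

lemma isBoundedEvaluation_radialEval {n : ℕ} (hn : n ≠ 0) :
    IsBoundedEvaluation (radialMeasure R) (radialEval n R) := by
  refine ⟨⟨1, fun r => ?_⟩, fun g => aestronglyMeasurable_radialMeasure (continuousOn_radialEval n g)⟩
  by_cases hr : r ∈ Ioo 0 R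
  · rw [radialEval, dif_pos hr, innerSL_apply_norm]
    refine (sq_le_one_iff₀ (norm_nonneg _)).1 ?_
    rw [norm_sq_radialL2]
    refine le_trans (le_of_eq (integral_congr_ae ?_)) (integral_evalKernel_sq_le hn hr)
    filter_upwards [(memLp_evalKernel n hr).coeFn_toLp] with s hs
    rw [hs]
  · rw [radialEval, dif_neg hr]; simp

lemma exists_mass_radialEval_eq (hR : 0 < R) {n : ℕ} (hn : n ≠ 0) {q : ℝ} (hq : 0 < q) :
    ∃ g, mass (radialMeasure R) (radialEval n R) g = q := by
  have hmem : MemLp (fun s : ℝ => s ^ n) 2 (radialMeasure R) := by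
    refine (memLp_top_of_bound (C := R ^ n) (by fun_prop) ?_).mono_exponent le_top
    filter_upwards [ae_radialMeasure_mem] with s hs
    have := hs.1
    rw [Real.norm_eq_abs, abs_of_nonneg (by positivity)]
    gcongr
    exact hs.2.le
  set g : RadialL2 R := hmem.toLp with hg
  have hval : ∀ r ∈ Ioo 0 R, radialEval n R r g = -(r ^ n * (R - r)) := by
    intro r hr
    rw [radialEval_apply n hr, radialPrimitive]
    have : ∫ s in r..R, g s / s ^ n = ∫ s in r..R, (1 : ℝ) := by
      rw [intervalIntegral.integral_of_le hr.2.le, intervalIntegral.integral_of_le hr.2.le,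
        integral_Ioc_eq_integral_Ioo, integral_Ioc_eq_integral_Ioo]
      refine integral_congr_ae (ae_restrict_of_ae_restrict_of_subset
        (Ioo_subset_Ioo_left hr.1.le) ?_)
      filter_upwards [restrict_absolutelyContinuous_radialMeasure.ae_le hmem.coeFn_toLp,
        ae_restrict_mem measurableSet_Ioo] with s hs hs'
      rw [hg, hs, div_self (pow_ne_zero _ hs'.1.ne')]
    rw [this]; simp
  have hne : mass (radialMeasure R) (radialEval n R) g ≠ 0 := by
    intro h0
    have h1 := ae_radialMeasure_iff.1 ((isBoundedEvaluation_radialEval hn).ae_eq_zero h0)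
    have h2 : ∀ᵐ r ∂volume.restrict (Ioo 0 R), False := by
      filter_upwards [h1, ae_restrict_mem measurableSet_Ioo] with r hr hr'
      rw [hval r hr', neg_eq_zero] at hr
      have : 0 < r ^ n * (R - r) := mul_pos (pow_pos hr'.1 _) (sub_pos.2 hr'.2)
      exact this.ne' hr
    rw [eventually_false_iff_eq_bot, ae_eq_bot, Measure.restrict_eq_zero, Real.volume_Ioo] at h2
    simp at h2
    linarith
  obtain ⟨c, -, -, hc⟩ := exists_smul_mass_eq hne hq
  exact ⟨c • g, hc⟩

end Radial

/-! ### Regularity of solutions of the Euler–Lagrange equations -/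

section Regularity

variable {R : ℝ}

/-- The adjoint of `radialPrimitive n R` applied to `F`: the solution `G` of
`G' + (n + 1) G / r = -F` on `(0, R)` that is regular at the origin. -/
def radialAdjoint (n : ℕ) (F : ℝ → ℝ) (s : ℝ) : ℝ :=
  -((∫ r in (0 : ℝ)..s, r ^ (n + 1) * F r) / s ^ (n + 1))

lemma abs_radialAdjoint_le {n : ℕ} {F : ℝ → ℝ} {C : ℝ} (hF : ∀ r, |F r| ≤ C) {s : ℝ} (hs : 0 < s) :
    |radialAdjoint n F s| ≤ C * s := by
  have hb : ‖∫ r in (0 : ℝ)..s, r ^ (n + 1) * F r‖ ≤ s ^ (n + 1) * C * |s - 0| := by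
    refine intervalIntegral.norm_integral_le_of_norm_le_const fun r hr => ?_
    rw [uIoc_of_le hs.le] at hr
    have := hr.1
    rw [norm_mul, Real.norm_eq_abs, Real.norm_eq_abs, abs_of_nonneg (by positivity)]
    gcongr
    · exact hr.2
    · exact hF r
  rw [Real.norm_eq_abs, sub_zero, abs_of_pos hs] at hb
  rw [radialAdjoint, abs_neg, abs_div, abs_of_pos (pow_pos hs _), div_le_iff₀ (pow_pos hs _)]
  linarith

lemma integrableOn_pow_mul {n : ℕ} {F : ℝ → ℝ} {C : ℝ} (hF : ∀ r, |F r| ≤ C)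
    (hm : AEStronglyMeasurable F (radialMeasure R)) :
    IntegrableOn (fun r => r ^ (n + 1) * F r) (Ioo 0 R) := by
  have : Integrable (fun r => r ^ n * F r) (radialMeasure R) := by
    refine Integrable.of_bound (C := R ^ n * C)
      ((by fun_prop : Continuous fun r : ℝ => r ^ n).aestronglyMeasurable.mul hm) ?_
    filter_upwards [ae_radialMeasure_mem] with r hr
    have := hr.1
    have := hr.1.trans hr.2
    rw [norm_mul, Real.norm_eq_abs, Real.norm_eq_abs, abs_of_nonneg (by positivity)]
    gcongr
    · exact hr.2.le
    · exact hF r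
  refine (integrable_radialMeasure_iff.1 this).congr (ae_of_all _ fun r => ?_)
  simp only []; ring

lemma hasDerivAt_radialAdjoint {n : ℕ} {F : ℝ → ℝ} {C : ℝ} (hF : ∀ r, |F r| ≤ C)
    (hc : ContinuousOn F (Ioo 0 R)) {s : ℝ} (hs : s ∈ Ioo 0 R) :
    HasDerivAt (radialAdjoint n F) (-F s - (n + 1) * radialAdjoint n F s / s) s := by
  have hs0 : s ≠ 0 := hs.1.ne'
  have hi : IntervalIntegrable (fun r => r ^ (n + 1) * F r) volume 0 s :=
    (intervalIntegrable_iff_integrableOn_Ioo_of_le hs.1.le).2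
      ((integrableOn_pow_mul hF (aestronglyMeasurable_radialMeasure hc)).mono_set
        (Ioo_subset_Ioo_right hs.2.le))
  have hcm : ContinuousOn (fun r => r ^ (n + 1) * F r) (Ioo 0 R) :=
    (continuous_pow (n + 1)).continuousOn.mul hc
  have h1 := intervalIntegral.integral_hasDerivAt_right hi
    (hcm.stronglyMeasurableAtFilter isOpen_Ioo s hs) (hcm.continuousAt (isOpen_Ioo.mem_nhds hs))
  have h2 := (h1.div (hasDerivAt_pow (n + 1) s) (pow_ne_zero _ hs0)).neg
  refine h2.congr_deriv ?_
  unfold radialAdjoint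
  push_cast
  field_simp
  ring

lemma continuousOn_radialAdjoint {n : ℕ} {F : ℝ → ℝ} {C : ℝ} (hF : ∀ r, |F r| ≤ C)
    (hc : ContinuousOn F (Ioo 0 R)) : ContinuousOn (radialAdjoint n F) (Ioo 0 R) :=
  fun _ hs => (hasDerivAt_radialAdjoint hF hc hs).continuousAt.continuousWithinAt

lemma memLp_radialAdjoint {n : ℕ} {F : ℝ → ℝ} {C : ℝ} (hF : ∀ r, |F r| ≤ C)
    (hc : ContinuousOn F (Ioo 0 R)) : MemLp (radialAdjoint n F) 2 (radialMeasure R) := by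
  have hC : 0 ≤ C := (abs_nonneg _).trans (hF 0)
  refine (memLp_top_of_bound (C := C * R) (aestronglyMeasurable_radialMeasure
    (continuousOn_radialAdjoint hF hc)) ?_).mono_exponent le_top
  filter_upwards [ae_radialMeasure_mem] with r hr
  exact (abs_radialAdjoint_le hF hr.1).trans (by gcongr; exact hr.2.le)

lemma integral_mul_radialEval {n : ℕ} {F : ℝ → ℝ} {C : ℝ} (hF : ∀ r, |F r| ≤ C)
    (hm : AEStronglyMeasurable F (radialMeasure R)) (k : RadialL2 R) :
    ∫ r, F r * radialEval n R r k ∂radialMeasure R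
      = ∫ s, radialAdjoint n F s * k s ∂radialMeasure R := by
  have hC : 0 ≤ C := (abs_nonneg _).trans (hF 0)
  set ν : Measure ℝ := volume.restrict (Ioo 0 R) with hν
  set Φ : ℝ × ℝ → ℝ := {p : ℝ × ℝ | p.1 < p.2}.indicator
    fun p => -(p.1 ^ (n + 1) * F p.1 * (k p.2 / p.2 ^ n)) with hΦ
  have hmem : ∀ᵐ p ∂ν.prod ν, p ∈ Ioo 0 R ×ˢ Ioo 0 R := by
    rw [hν, Measure.prod_restrict]
    exact ae_restrict_mem (measurableSet_Ioo.prod measurableSet_Ioo)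
  have hk : Integrable (fun s => k s * s) ν :=
    integrable_radialMeasure_iff.1 ((Lp.memLp k).integrable one_le_two)
  have hkm : AEStronglyMeasurable (fun s => k s / s ^ n) ν := by
    simp only [div_eq_mul_inv]
    exact ((Lp.aestronglyMeasurable k).mono_ac restrict_absolutelyContinuous_radialMeasure).mul
      (by fun_prop : Measurable fun s : ℝ => (s ^ n)⁻¹).aestronglyMeasurable
  have hFm : AEStronglyMeasurable (fun r => r ^ (n + 1) * F r) ν :=
    (by fun_prop : Measurable fun s : ℝ => s ^ (n + 1)).aestronglyMeasurable.mul
      (hm.mono_ac restrict_absolutelyContinuous_radialMeasure)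
  have hint : Integrable Φ (ν.prod ν) := by
    have hb : Integrable (fun p : ℝ × ℝ => C * ‖k p.2 * p.2‖) (ν.prod ν) :=
      (integrable_const C).mul_prod hk.norm
    refine hb.mono' ?_ ?_
    · exact ((hFm.comp_fst.mul hkm.comp_snd).neg).indicator
        (measurableSet_lt measurable_fst measurable_snd)
    · filter_upwards [hmem] with p hp
      have h1 : 0 < p.1 := hp.1.1
      have h2 : 0 < p.2 := hp.2.1
      by_cases hlt : p ∈ {p : ℝ × ℝ | p.1 < p.2}
      · rw [hΦ, indicator_of_mem hlt, norm_neg, norm_mul, norm_mul, norm_mul, norm_div,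
          Real.norm_of_nonneg (by positivity : 0 ≤ p.1 ^ (n + 1)),
          Real.norm_of_nonneg (by positivity : 0 ≤ p.2 ^ n), Real.norm_of_nonneg h2.le]
        have hpow : p.1 ^ (n + 1) ≤ p.2 ^ (n + 1) := pow_le_pow_left₀ h1.le (le_of_lt hlt) _
        calc p.1 ^ (n + 1) * ‖F p.1‖ * (‖k p.2‖ / p.2 ^ n)
            ≤ p.2 ^ (n + 1) * C * (‖k p.2‖ / p.2 ^ n) := by
              gcongr
              exact hF p.1
          _ = C * (‖k p.2‖ * p.2) := by field_simp; ring
      · rw [hΦ, indicator_of_notMem hlt, norm_zero]; positivity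
  have hswap := integral_integral_swap (f := fun r s => Φ (r, s)) hint
  rw [integral_radialMeasure, integral_radialMeasure]
  have hL : ∀ r ∈ Ioo 0 R, F r * radialEval n R r k * r = ∫ s, Φ (r, s) ∂ν := by
    intro r hr
    have : ∀ s, Φ (r, s) = (Ioi r).indicator
        (fun s => -(r ^ (n + 1) * F r) * (k s / s ^ n)) s := fun s => by
      simp only [hΦ, indicator, mem_ofPred_eq, mem_Ioi, neg_mul]
    simp only [this]
    rw [hν, setIntegral_indicator measurableSet_Ioi]
    have hset : Ioo 0 R ∩ Ioi r = Ioo r R := by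
      ext x
      exact ⟨fun h => ⟨h.2, h.1.2⟩, fun h => ⟨⟨hr.1.trans h.1, h.2⟩, h.1⟩⟩
    rw [hset, integral_const_mul, radialEval_apply n hr, radialPrimitive,
      intervalIntegral.integral_of_le hr.2.le, integral_Ioc_eq_integral_Ioo]
    ring
  have hRt : ∀ s ∈ Ioo 0 R, radialAdjoint n F s * k s * s = ∫ r, Φ (r, s) ∂ν := by
    intro s hs
    have : ∀ r, Φ (r, s) = (Iio s).indicator
        (fun r => (r ^ (n + 1) * F r) * -(k s / s ^ n)) r := fun r => by
      simp only [hΦ, indicator, mem_ofPred_eq, mem_Iio, mul_neg]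
    simp only [this]
    rw [hν, setIntegral_indicator measurableSet_Iio]
    have hset : Ioo 0 R ∩ Iio s = Ioo 0 s := by
      ext x
      exact ⟨fun h => ⟨h.1.1, h.2⟩, fun h => ⟨⟨h.1, h.2.trans hs.2⟩, h.2⟩⟩
    rw [hset, integral_mul_const, radialAdjoint,
      intervalIntegral.integral_of_le hs.1.le, integral_Ioc_eq_integral_Ioo]
    have := hs.1.ne'
    field_simp
    ring
  rw [setIntegral_congr_fun measurableSet_Ioo hL, setIntegral_congr_fun measurableSet_Ioo hRt]
  exact hswap

lemma contDiffOn_of_hasDerivAt {f f' : ℝ → ℝ} {s : Set ℝ} (hs : IsOpen s) {n : ℕ}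
    (hf : ∀ x ∈ s, HasDerivAt f (f' x) x) (hf' : ContDiffOn ℝ n f' s) :
    ContDiffOn ℝ (n + 1) f s := by
  rw [contDiffOn_succ_iff_deriv_of_isOpen hs]
  refine ⟨fun x hx => (hf x hx).differentiableAt.differentiableWithinAt, by simp, ?_⟩
  exact hf'.congr fun x hx => (hf x hx).deriv

/-- The absolutely continuous functions on `[0, R]` that vanish at the endpoints and for which
`∫ (A'² + A² / r²) r dr` is finite. -/
structure FiniteEnergy (R : ℝ) (A : ℝ → ℝ) : Prop where
  ac : AbsolutelyContinuousOnInterval A 0 R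
  left : A 0 = 0
  right : A R = 0
  deriv_memLp : MemLp (deriv A) 2 (radialMeasure R)
  div_memLp : MemLp (fun r => A r / r) 2 (radialMeasure R)

/-- `A` is a finite-energy function that is twice continuously differentiable on `(0, R)` and solves
`A'' + A' / r - n² A / r² = -F` there. -/
structure IsClassicalSolution (n : ℕ) (R : ℝ) (F A : ℝ → ℝ) : Prop where
  finiteEnergy : FiniteEnergy R A
  contDiffOn : ContDiffOn ℝ 2 A (Ioo 0 R)
  equation : ∀ r ∈ Ioo 0 R,
    deriv (deriv A) r + (1 / r) * deriv A r - (n : ℝ) ^ 2 / r ^ 2 * A r = -F r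

lemma abs_radialPrimitive_le {n : ℕ} (hn : n ≠ 0) {g : ℝ → ℝ} {C : ℝ} (hC : 0 ≤ C)
    (hg : ∀ s, 0 < s → |g s| ≤ C * s) {r : ℝ} (hr : r ∈ Ioo 0 R) :
    |radialPrimitive n R g r| ≤ C * r * (R - r) := by
  have hr0 := hr.1
  have hb : ‖∫ s in r..R, g s / s ^ n‖ ≤ C * r / r ^ n * |R - r| := by
    refine intervalIntegral.norm_integral_le_of_norm_le_const fun s hs => ?_
    rw [uIoc_of_le hr.2.le] at hs
    have hs0 : 0 < s := hr.1.trans hs.1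
    obtain ⟨m, rfl⟩ := Nat.exists_eq_succ_of_ne_zero hn
    rw [norm_div, Real.norm_of_nonneg (by positivity : 0 ≤ s ^ (m.succ)), Real.norm_eq_abs]
    calc |g s| / s ^ m.succ ≤ C * s / s ^ m.succ := by gcongr; exact hg s hs0
      _ = C / s ^ m := by rw [pow_succ]; field_simp
      _ ≤ C / r ^ m := by gcongr; exact hs.1.le
      _ = C * r / r ^ m.succ := by rw [pow_succ]; field_simp
  rw [radialPrimitive, abs_neg, abs_mul, abs_of_nonneg (by positivity : 0 ≤ r ^ n)]
  rw [Real.norm_eq_abs, abs_of_pos (sub_pos.2 hr.2)] at hb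
  calc r ^ n * |∫ s in r..R, g s / s ^ n| ≤ r ^ n * (C * r / r ^ n * (R - r)) := by gcongr
    _ = C * r * (R - r) := by field_simp

/-- A function that is differentiable with bounded derivative on `(0, R)` and tends to its value `0`
at both endpoints at least linearly is Lipschitz on `[0, R]`. -/
lemma lipschitzOnWith_Icc {A : ℝ → ℝ} {K : NNReal} (h0 : A 0 = 0) (h1 : A R = 0)
    (hd : ∀ r ∈ Ioo 0 R, DifferentiableAt ℝ A r) (hK : ∀ r ∈ Ioo 0 R, ‖deriv A r‖₊ ≤ K)
    (hl : ∀ r ∈ Ioo 0 R, |A r| ≤ K * r) (hr : ∀ r ∈ Ioo 0 R, |A r| ≤ K * (R - r)) :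
    LipschitzOnWith K A (Icc 0 R) := by
  have hin := (convex_Ioo 0 R).lipschitzOnWith_of_nnnorm_deriv_le hd hK
  have key : ∀ x ∈ Icc 0 R, ∀ y ∈ Icc 0 R, x < y → dist (A x) (A y) ≤ K * dist x y := by
    intro x hx y hy hxy
    rw [dist_comm x y, Real.dist_eq y x, abs_of_pos (sub_pos.2 hxy)]
    have hK0 : (0 : ℝ) ≤ K := K.2
    rcases hx.1.eq_or_lt with rfl | hx0
    · rcases hy.2.eq_or_lt with rfl | hyR
      · rw [h0, h1, dist_self]; exact mul_nonneg hK0 (by linarith)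
      · rw [h0, dist_zero_left, Real.norm_eq_abs, sub_zero]
        exact hl y ⟨hxy, hyR⟩
    · rcases hy.2.eq_or_lt with rfl | hyR
      · rw [h1, dist_zero_right, Real.norm_eq_abs]
        exact hr x ⟨hx0, hxy⟩
      · have := hin.dist_le_mul x ⟨hx0, hxy.trans hyR⟩ y ⟨hx0.trans hxy, hyR⟩
        rwa [dist_comm x y, Real.dist_eq y x, abs_of_pos (sub_pos.2 hxy)] at this
  refine LipschitzOnWith.of_dist_le_mul fun x hx y hy => ?_
  rcases lt_trichotomy x y with h | rfl | h
  · exact key x hx y hy h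
  · simp
  · rw [dist_comm, dist_comm x y]; exact key y hy x hx h

/-- Regularity: if `g` represents the functional `k ↦ ∫ F · radialEval k`, where `F` is bounded and
continuous, then `A = radialEval g` is a classical solution of `A'' + A'/r - n² A/r² = -F`. The
operator factors as `(d/dr + (n+1)/r) (d/dr - n/r)`, and the two factors are inverted by
`radialAdjoint` and `radialPrimitive`. The bound `|A r| ≤ C r (R - r)` makes `A` Lipschitz. -/
theorem isClassicalSolution_of_inner_eq (hR : 0 < R) {n : ℕ} (hn : n ≠ 0) {F : ℝ → ℝ} {C : ℝ}
    (hF : ∀ r, |F r| ≤ C) (hc : ContinuousOn F (Ioo 0 R)) {g : RadialL2 R}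
    (hg : ∀ k : RadialL2 R, ⟪g, k⟫_ℝ = ∫ r, F r * radialEval n R r k ∂radialMeasure R) :
    IsClassicalSolution n R F (fun r => radialEval n R r g) ∧
      g =ᵐ[radialMeasure R] fun r =>
        deriv (fun r => radialEval n R r g) r - n * (radialEval n R r g / r) := by
  have hC : 0 ≤ C := (abs_nonneg _).trans (hF 0)
  set G := radialAdjoint n F with hG
  have hGm : MemLp G 2 (radialMeasure R) := memLp_radialAdjoint hF hc
  have hgG : g = hGm.toLp := by
    refine ext_inner_right ℝ fun k => ?_
    rw [hg, integral_mul_radialEval hF (aestronglyMeasurable_radialMeasure hc), inner_radialL2]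
    refine integral_congr_ae ?_
    filter_upwards [hGm.coeFn_toLp] with s hs
    rw [hs]
  have hgae : g =ᵐ[radialMeasure R] G := hgG ▸ hGm.coeFn_toLp
  set A : ℝ → ℝ := fun r => radialEval n R r g with hA
  have hAG : ∀ r ∈ Ioo 0 R, A r = radialPrimitive n R G r := by
    intro r hr
    rw [hA]
    simp only []
    rw [radialEval_apply n hr, ← integral_evalKernel_mul n hr, ← integral_evalKernel_mul n hr]
    refine integral_congr_ae ?_
    filter_upwards [hgae] with s hs
    rw [hs]
  have hGc : ContinuousOn G (Ioo 0 R) := continuousOn_radialAdjoint hF hc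
  have hAd : ∀ r ∈ Ioo 0 R, HasDerivAt A (n * A r / r + G r) r := by
    intro r hr
    rw [hAG r hr]
    refine (hasDerivAt_radialPrimitive hGm hr hGc).congr_of_eventuallyEq ?_
    filter_upwards [isOpen_Ioo.mem_nhds hr] with x hx using hAG x hx
  have hGd : ∀ r ∈ Ioo 0 R, HasDerivAt G (-F r - (n + 1) * G r / r) r := fun r hr =>
    hasDerivAt_radialAdjoint hF hc hr
  have hA0 : A 0 = 0 := radialEval_of_notMem n (by simp) g
  have hAR : A R = 0 := radialEval_of_notMem n (by simp) g
  have hAb : ∀ r ∈ Ioo 0 R, |A r| ≤ C * r * (R - r) := fun r hr => by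
    rw [hAG r hr]
    exact abs_radialPrimitive_le hn hC (fun s hs => abs_radialAdjoint_le hF hs) hr
  have hAr : ∀ r ∈ Ioo 0 R, |A r / r| ≤ C * R := fun r hr => by
    rw [abs_div, abs_of_pos hr.1, div_le_iff₀ hr.1]
    refine (hAb r hr).trans ?_
    nlinarith [mul_nonneg (mul_nonneg hC hr.1.le) hr.1.le]
  have hderiv : ∀ r ∈ Ioo 0 R, deriv A r = n * A r / r + G r := fun r hr => (hAd r hr).deriv
  have hdb : ∀ r ∈ Ioo 0 R, |deriv A r| ≤ (n + 1) * (C * R) := fun r hr => by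
    rw [hderiv r hr, mul_div_assoc]
    refine (abs_add_le _ _).trans ?_
    have h1 : |G r| ≤ C * R := (abs_radialAdjoint_le hF hr.1).trans (by gcongr; exact hr.2.le)
    rw [abs_mul, Nat.abs_cast]
    have := mul_le_mul_of_nonneg_left (hAr r hr) (Nat.cast_nonneg (α := ℝ) n)
    linarith
  have hAc : ContinuousOn A (Ioo 0 R) := continuousOn_radialEval n g
  have hdc : ContinuousOn (fun r => n * A r / r + G r) (Ioo 0 R) :=
    ((continuousOn_const.mul hAc).div continuousOn_id fun r hr => hr.1.ne').add hGc
  refine ⟨⟨⟨?_, hA0, hAR, ?_, ?_⟩, ?_, ?_⟩, ?_⟩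
  · have hK : 0 ≤ (n + 1) * (C * R) := by positivity
    have hCR : C * R ≤ (n + 1) * (C * R) := by
      have : 0 ≤ n * (C * R) := by positivity
      linarith
    have hlip := lipschitzOnWith_Icc (R := R) (A := A) (K := ⟨_, hK⟩) hA0 hAR
      (fun r hr => (hAd r hr).differentiableAt) (fun r hr => hdb r hr)
      (fun r hr => ?_) (fun r hr => ?_)
    · rw [← uIcc_of_le hR.le] at hlip
      exact hlip.absolutelyContinuousOnInterval
    · have h1 := hAr r hr
      rw [abs_div, abs_of_pos hr.1, div_le_iff₀ hr.1] at h1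
      exact h1.trans (mul_le_mul_of_nonneg_right hCR hr.1.le)
    · refine (hAb r hr).trans (mul_le_mul_of_nonneg_right ?_ (sub_nonneg.2 hr.2.le))
      exact (mul_le_mul_of_nonneg_left hr.2.le hC).trans hCR
  · refine (memLp_top_of_bound (C := (n + 1) * (C * R))
      (measurable_deriv A).aestronglyMeasurable ?_).mono_exponent le_top
    filter_upwards [ae_radialMeasure_mem] with r hr using hdb r hr
  · refine (memLp_top_of_bound (C := C * R) (aestronglyMeasurable_radialMeasure
      (hAc.div continuousOn_id fun r hr => hr.1.ne')) ?_).mono_exponent le_top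
    filter_upwards [ae_radialMeasure_mem] with r hr using hAr r hr
  · have hA1 : ContDiffOn ℝ 1 A (Ioo 0 R) := by
      have := contDiffOn_of_hasDerivAt (n := 0) isOpen_Ioo hAd (contDiffOn_zero.2 hdc)
      simpa using this
    have hG1 : ContDiffOn ℝ 1 G (Ioo 0 R) := by
      have := contDiffOn_of_hasDerivAt (n := 0) isOpen_Ioo hGd (contDiffOn_zero.2 (hc.neg.sub
        ((continuousOn_const.mul hGc).div continuousOn_id fun r hr => hr.1.ne')))
      simpa using this
    have := contDiffOn_of_hasDerivAt (n := 1) isOpen_Ioo hAd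
      (((contDiffOn_const.mul hA1).div contDiffOn_id fun r hr => hr.1.ne').add hG1)
    simpa [one_add_one_eq_two] using this
  · intro r hr
    have hr0 := hr.1.ne'
    have h2 : HasDerivAt (deriv A) ((n * (n * A r / r + G r) * r - n * A r * 1) / r ^ 2
        + (-F r - (n + 1) * G r / r)) r := by
      refine ((((hAd r hr).const_mul (n : ℝ)).div (hasDerivAt_id r) hr0).add
        (hGd r hr)).congr_of_eventuallyEq ?_
      filter_upwards [isOpen_Ioo.mem_nhds hr] with x hx using hderiv x hx
    rw [h2.deriv, hderiv r hr]
    field_simp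
    ring
  · filter_upwards [hgae, ae_radialMeasure_mem] with r hr hr'
    rw [hr, hderiv r hr']
    ring

end Regularity

/-! ### The admissible class and the Hilbert space variables -/

section Admissible

variable {R : ℝ}

lemma _root_.AbsolutelyContinuousOnInterval.abs {f : ℝ → ℝ} {a b : ℝ}
    (hf : AbsolutelyContinuousOnInterval f a b) :
    AbsolutelyContinuousOnInterval (fun x => |f x|) a b := by
  refine squeeze_zero (fun t => Finset.sum_nonneg fun i _ => dist_nonneg) (fun t => ?_) hf
  gcongr
  rw [Real.dist_eq, Real.dist_eq]
  exact abs_abs_sub_abs_le_abs_sub _ _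

namespace FiniteEnergy

variable {A B : ℝ → ℝ}

lemma continuousOn (hA : FiniteEnergy R A) (hR : 0 < R) : ContinuousOn A (Icc 0 R) := by
  simpa [uIcc_of_le hR.le] using hA.ac.continuousOn

lemma ae_differentiableAt (hA : FiniteEnergy R A) (hR : 0 < R) :
    ∀ᵐ r ∂radialMeasure R, DifferentiableAt ℝ A r := by
  rw [ae_radialMeasure_iff]
  filter_upwards [ae_restrict_of_ae hA.ac.ae_differentiableAt, ae_restrict_mem measurableSet_Ioo]
    with r hr hr'
  exact hr (by rw [uIcc_of_le hR.le]; exact Ioo_subset_Icc_self hr')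

lemma memLp_top (hA : FiniteEnergy R A) (hR : 0 < R) : MemLp A ⊤ (radialMeasure R) := by
  obtain ⟨C, hC⟩ := hA.ac.exists_bound
  refine memLp_top_of_bound (aestronglyMeasurable_radialMeasure
    ((hA.continuousOn hR).mono Ioo_subset_Icc_self)) C ?_
  filter_upwards [ae_radialMeasure_mem] with r hr
  exact hC r (by rw [uIcc_of_le hR.le]; exact Ioo_subset_Icc_self hr)

lemma deriv_add_smul (hA : FiniteEnergy R A) (hB : FiniteEnergy R B) (hR : 0 < R) (t : ℝ) :
    deriv (fun r => A r + t * B r) =ᵐ[radialMeasure R] fun r => deriv A r + t * deriv B r := by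
  filter_upwards [hA.ae_differentiableAt hR, hB.ae_differentiableAt hR] with r h1 h2
  exact (h1.hasDerivAt.add (h2.hasDerivAt.const_mul t)).deriv

lemma add_smul (hA : FiniteEnergy R A) (hB : FiniteEnergy R B) (hR : 0 < R) (t : ℝ) :
    FiniteEnergy R (fun r => A r + t * B r) where
  ac := hA.ac.add (hB.ac.const_mul t)
  left := by simp [hA.left, hB.left]
  right := by simp [hA.right, hB.right]
  deriv_memLp := (memLp_congr_ae (hA.deriv_add_smul hB hR t)).2
    (hA.deriv_memLp.add (hB.deriv_memLp.const_mul t))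
  div_memLp := by
    refine (memLp_congr_ae (ae_of_all _ fun r => ?_)).2
      (hA.div_memLp.add (hB.div_memLp.const_mul t))
    simp only [Pi.add_apply]
    ring

/-- Taking absolute values does not increase the derivative: where `A` vanishes, `|A|` has a
minimum, so its derivative (also the junk value) is `0`. -/
lemma abs_deriv_abs_le (hA : FiniteEnergy R A) (hR : 0 < R) :
    ∀ᵐ r ∂radialMeasure R, |deriv (fun r => |A r|) r| ≤ |deriv A r| := by
  filter_upwards [hA.ae_differentiableAt hR] with r hr
  by_cases h0 : A r = 0
  · have hmin : IsLocalMin (fun r => |A r|) r := Eventually.of_forall fun x => by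
      simp [h0]
    rw [hmin.deriv_eq_zero, abs_zero]
    exact abs_nonneg _
  · have := ((hasDerivAt_abs h0).comp r hr.hasDerivAt).deriv
    change deriv (fun r => |A r|) r = _ at this
    rw [this, abs_mul]
    refine mul_le_of_le_one_left (abs_nonneg _) ?_
    rcases lt_or_gt_of_ne h0 with h | h <;> simp [h]

lemma abs (hA : FiniteEnergy R A) (hR : 0 < R) : FiniteEnergy R (fun r => |A r|) where
  ac := hA.ac.abs
  left := by simp [hA.left]
  right := by simp [hA.right]
  deriv_memLp := hA.deriv_memLp.mono (measurable_deriv _).aestronglyMeasurable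
    (hA.abs_deriv_abs_le hR)
  div_memLp := by
    refine hA.div_memLp.mono ?_ (ae_of_all _ fun r => by simp)
    exact aestronglyMeasurable_radialMeasure (((hA.continuousOn hR).mono Ioo_subset_Icc_self).abs.div
      continuousOn_id fun r hr => hr.1.ne')

end FiniteEnergy

lemma integrable_interaction {A₁ A₂ : ℝ → ℝ} (hR : 0 < R)
    (h₁ : AbsolutelyContinuousOnInterval A₁ 0 R) (h₂ : AbsolutelyContinuousOnInterval A₂ 0 R) :
    Integrable (fun r => A₁ r ^ 2 * A₂ r) (radialMeasure R) := by
  rw [integrable_radialMeasure_iff]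
  have hc : ContinuousOn (fun r => A₁ r ^ 2 * A₂ r * r) (Icc 0 R) := by
    rw [← uIcc_of_le hR.le]
    exact ((h₁.continuousOn.pow 2).mul h₂.continuousOn).mul continuousOn_id
  exact hc.integrableOn_Icc.mono_set Ioo_subset_Icc_self

lemma admissible_iff (hR : 0 < R) {A₁ A₂ : ℝ → ℝ} :
    Admissible R A₁ A₂ ↔ FiniteEnergy R A₁ ∧ FiniteEnergy R A₂ := by
  have hE : IntervalIntegrable (energyDensity A₁ A₂) volume 0 R ↔
      Integrable (fun r => deriv A₁ r ^ 2 + deriv A₂ r ^ 2 + A₁ r ^ 2 / r ^ 2 + A₂ r ^ 2 / r ^ 2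
        + A₁ r ^ 2 * A₂ r) (radialMeasure R) := by
    rw [integrable_radialMeasure_iff, intervalIntegrable_iff_integrableOn_Ioo_of_le hR.le]
    rfl
  constructor
  · intro h
    have hS : Integrable (fun r => deriv A₁ r ^ 2 + deriv A₂ r ^ 2 + (A₁ r / r) ^ 2
        + (A₂ r / r) ^ 2) (radialMeasure R) := by
      refine ((hE.1 h.finiteEnergy).sub (integrable_interaction hR h.ac₁ h.ac₂)).congr
        (ae_of_all _ fun r => ?_)
      simp only [Pi.sub_apply, div_pow]
      ring
    have hm : ∀ {A : ℝ → ℝ}, AbsolutelyContinuousOnInterval A 0 R →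
        AEStronglyMeasurable (fun r => A r / r) (radialMeasure R) := fun hA => by
      have hc := hA.continuousOn
      rw [uIcc_of_le hR.le] at hc
      exact aestronglyMeasurable_radialMeasure ((hc.mono Ioo_subset_Icc_self).div
        continuousOn_id fun r hr => hr.1.ne')
    have key : ∀ {f : ℝ → ℝ}, AEStronglyMeasurable f (radialMeasure R) →
        (∀ r, f r ^ 2 ≤ deriv A₁ r ^ 2 + deriv A₂ r ^ 2 + (A₁ r / r) ^ 2 + (A₂ r / r) ^ 2) →
        MemLp f 2 (radialMeasure R) := fun hf hle => by
      rw [memLp_two_iff_integrable_sq hf]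
      refine hS.mono' (hf.pow 2) (ae_of_all _ fun r => ?_)
      rw [Real.norm_of_nonneg (sq_nonneg _)]
      exact hle r
    refine ⟨⟨h.ac₁, h.bdy.left₁, h.bdy.right₁, key (measurable_deriv _).aestronglyMeasurable ?_,
      key (hm h.ac₁) ?_⟩, ⟨h.ac₂, h.bdy.left₂, h.bdy.right₂,
      key (measurable_deriv _).aestronglyMeasurable ?_, key (hm h.ac₂) ?_⟩⟩
    all_goals
      intro r
      nlinarith [sq_nonneg (deriv A₁ r), sq_nonneg (deriv A₂ r), sq_nonneg (A₁ r / r),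
        sq_nonneg (A₂ r / r)]
  · rintro ⟨h₁, h₂⟩
    refine ⟨h₁.ac, h₂.ac, ⟨h₁.left, h₁.right, h₂.left, h₂.right⟩, hE.2 ?_⟩
    have := (((h₁.deriv_memLp.integrable_sq.add h₂.deriv_memLp.integrable_sq).add
      h₁.div_memLp.integrable_sq).add h₂.div_memLp.integrable_sq).add
      (integrable_interaction hR h₁.ac h₂.ac)
    refine this.congr (ae_of_all _ fun r => ?_)
    simp only [Pi.add_apply, div_pow]

/-- `g` is the Hilbert space variable of `A`: it represents `A' - n A / r` in `L²(r dr)`. -/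
def Represents (n : ℕ) (R : ℝ) (A : ℝ → ℝ) (g : RadialL2 R) : Prop :=
  g =ᵐ[radialMeasure R] fun r => deriv A r - n * (A r / r)

lemma FiniteEnergy.exists_represents {A : ℝ → ℝ} (hA : FiniteEnergy R A) (n : ℕ) :
    ∃ g, Represents n R A g :=
  ⟨_, (hA.deriv_memLp.sub (hA.div_memLp.const_mul (n : ℝ))).coeFn_toLp⟩

namespace Represents

variable {n : ℕ} {A B : ℝ → ℝ} {g k : RadialL2 R}

lemma add_smul (hg : Represents n R A g) (hk : Represents n R B k) (hA : FiniteEnergy R A)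
    (hB : FiniteEnergy R B) (hR : 0 < R) (t : ℝ) :
    Represents n R (fun r => A r + t * B r) (g + t • k) := by
  filter_upwards [hg, hk, hA.deriv_add_smul hB hR t, Lp.coeFn_add g (t • k), Lp.coeFn_smul t k]
    with r h1 h2 h3 h4 h5
  rw [h4, Pi.add_apply, h5, Pi.smul_apply, h1, h2, h3, smul_eq_mul]
  ring

lemma radialEval_eq (hg : Represents n R A g) (hA : FiniteEnergy R A) {r : ℝ} (hr : r ∈ Icc 0 R) :
    radialEval n R r g = A r := by
  rcases hr.1.eq_or_lt with rfl | hr0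
  · rw [hA.left, radialEval_of_notMem n (by simp)]
  rcases hr.2.eq_or_lt with rfl | hrR
  · rw [hA.right, radialEval_of_notMem n (by simp)]
  have hne : ∀ s ∈ uIcc r R, s ≠ 0 := fun s hs => by
    rw [uIcc_of_le hrR.le] at hs
    exact (hr0.trans_le hs.1).ne'
  have hAr : AbsolutelyContinuousOnInterval A r R := hA.ac.mono (by
    rw [uIcc_of_le hrR.le, uIcc_of_le (hr0.trans hrR).le]; exact Icc_subset_Icc_left hr0.le)
  have hpw : AbsolutelyContinuousOnInterval (fun s : ℝ => (s ^ n)⁻¹) r R :=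
    ContDiffOn.absolutelyContinuousOnInterval
      (ContDiffOn.inv (by fun_prop) fun s hs => pow_ne_zero _ (hne s hs))
  have hd : ∀ s ∈ uIcc r R, deriv (fun s : ℝ => (s ^ n)⁻¹) s = -(n / s ^ (n + 1)) := fun s hs => by
    have hder := ((hasDerivAt_pow n s).inv (pow_ne_zero _ (hne s hs))).deriv
    change deriv (fun s : ℝ => (s ^ n)⁻¹) s = _ at hder
    rw [hder]
    have := hne s hs
    rcases n with _ | n
    · simp
    · simp only [Nat.add_sub_cancel]
      field_simp
      ring
  have hparts := hpw.integral_mul_deriv_eq_deriv_mul hAr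
  rw [hA.right, mul_zero, zero_sub] at hparts
  rw [radialEval_apply n ⟨hr0, hrR⟩, radialPrimitive]
  have hI1 : IntervalIntegrable (fun s => (s ^ n)⁻¹ * deriv A s) volume r R :=
    hAr.intervalIntegrable_deriv.continuousOn_mul hpw.continuousOn
  have hI2 : IntervalIntegrable (fun s => deriv (fun s : ℝ => (s ^ n)⁻¹) s * A s) volume r R :=
    hpw.intervalIntegrable_deriv.mul_continuousOn hAr.continuousOn
  have hint : ∫ s in r..R, g s / s ^ n
      = ∫ s in r..R, ((s ^ n)⁻¹ * deriv A s + deriv (fun s : ℝ => (s ^ n)⁻¹) s * A s) := by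
    rw [intervalIntegral.integral_of_le hrR.le, intervalIntegral.integral_of_le hrR.le,
      integral_Ioc_eq_integral_Ioo, integral_Ioc_eq_integral_Ioo]
    refine integral_congr_ae ?_
    filter_upwards [ae_restrict_of_ae_restrict_of_subset (Ioo_subset_Ioo_left hr0.le)
      (ae_radialMeasure_iff.1 hg), ae_restrict_mem measurableSet_Ioo] with s hs hs'
    have hmem : s ∈ uIcc r R := by rw [uIcc_of_le hrR.le]; exact Ioo_subset_Icc_self hs'
    have := hne s hmem
    rw [hs, hd s hmem]
    field_simp
    ring
  rw [hint, intervalIntegral.integral_add hI1 hI2, hparts]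
  have := pow_ne_zero n hr0.ne'
  field_simp
  ring

lemma norm_sq (hg : Represents n R A g) (hA : FiniteEnergy R A) (hR : 0 < R) :
    ‖g‖ ^ 2 = ∫ r, (deriv A r ^ 2 + (n : ℝ) ^ 2 * (A r / r) ^ 2) ∂radialMeasure R := by
  -- the cross term is the integral of `(A²)'`, and `A` vanishes at both endpoints
  have hcross : ∫ r, deriv A r * (A r / r) ∂radialMeasure R = 0 := by
    have hparts := hA.ac.integral_mul_deriv_eq_deriv_mul hA.ac
    rw [hA.right, hA.left, mul_zero, sub_zero, zero_sub] at hparts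
    have hcomm : ∫ r in (0 : ℝ)..R, A r * deriv A r = ∫ r in (0 : ℝ)..R, deriv A r * A r := by
      simp only [mul_comm]
    have h0 : ∫ r in (0 : ℝ)..R, deriv A r * A r = 0 := by linarith
    rw [← h0, integral_radialMeasure, intervalIntegral.integral_of_le hR.le,
      integral_Ioc_eq_integral_Ioo]
    refine setIntegral_congr_fun measurableSet_Ioo fun r hr => ?_
    have := hr.1.ne'
    field_simp
  have hi : Integrable (fun r => deriv A r * (A r / r)) (radialMeasure R) :=
    hA.deriv_memLp.integrable_mul hA.div_memLp
  have hi2 : Integrable (fun r => deriv A r ^ 2 + (n : ℝ) ^ 2 * (A r / r) ^ 2) (radialMeasure R) :=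
    hA.deriv_memLp.integrable_sq.add (hA.div_memLp.integrable_sq.const_mul _)
  rw [norm_sq_radialL2]
  calc ∫ r, g r ^ 2 ∂radialMeasure R
      = ∫ r, ((deriv A r ^ 2 + (n : ℝ) ^ 2 * (A r / r) ^ 2)
          - 2 * n * (deriv A r * (A r / r))) ∂radialMeasure R := by
        refine integral_congr_ae ?_
        filter_upwards [hg] with r hr
        rw [hr]; ring
    _ = _ := by
        rw [integral_sub hi2 (hi.const_mul _), integral_const_mul, hcross, mul_zero, sub_zero]

lemma flux_eq (hg : Represents n R A g) (hA : FiniteEnergy R A) (hR : 0 < R) :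
    flux R A = 2 * Real.pi * mass (radialMeasure R) (radialEval n R) g := by
  rw [flux, intervalIntegral_eq_radialMeasure hR (fun r => A r ^ 2), mass]
  congr 1
  refine integral_congr_ae ?_
  filter_upwards [ae_radialMeasure_mem] with r hr
  rw [hg.radialEval_eq hA (Ioo_subset_Icc_self hr)]

end Represents

/-- The identity `A'² + n² A²/r² = (A' - n A/r)² + n (A²)'/r`, integrated against `r dr`,
diagonalizes the quadratic part of the action. -/
lemma action_eq_hilbertAction (hR : 0 < R) (l : ℤ) {A₁ A₂ : ℝ → ℝ} {g₁ g₂ : RadialL2 R}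
    (h₁ : FiniteEnergy R A₁) (h₂ : FiniteEnergy R A₂) (hg₁ : Represents l.natAbs R A₁ g₁)
    (hg₂ : Represents (2 * l.natAbs) R A₂ g₂) :
    action l R A₁ A₂ = hilbertAction (radialMeasure R) (radialEval l.natAbs R)
      (radialEval (2 * l.natAbs) R) g₁ g₂ := by
  have hl : ((l.natAbs : ℕ) : ℝ) ^ 2 = (l : ℝ) ^ 2 := by
    rw [Nat.cast_natAbs, Int.cast_abs, sq_abs]
  have hint : ∫ r, radialEval l.natAbs R r g₁ ^ 2 * radialEval (2 * l.natAbs) R r g₂ ∂radialMeasure R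
      = ∫ r, A₁ r ^ 2 * A₂ r ∂radialMeasure R := by
    refine integral_congr_ae ?_
    filter_upwards [ae_radialMeasure_mem] with r hr
    rw [hg₁.radialEval_eq h₁ (Ioo_subset_Icc_self hr), hg₂.radialEval_eq h₂ (Ioo_subset_Icc_self hr)]
  rw [hilbertAction, hint, hg₁.norm_sq h₁ hR, hg₂.norm_sq h₂ hR, action,
    intervalIntegral_eq_radialMeasure hR (fun r => deriv A₁ r ^ 2 + (1 / 2) * deriv A₂ r ^ 2
      + (l : ℝ) ^ 2 / r ^ 2 * A₁ r ^ 2 + 2 * (l : ℝ) ^ 2 / r ^ 2 * A₂ r ^ 2 - 2 * A₁ r ^ 2 * A₂ r)]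
  have hi1 : Integrable (fun r => deriv A₁ r ^ 2 + (l.natAbs : ℝ) ^ 2 * (A₁ r / r) ^ 2)
      (radialMeasure R) :=
    h₁.deriv_memLp.integrable_sq.add (h₁.div_memLp.integrable_sq.const_mul _)
  have hi2 : Integrable (fun r => deriv A₂ r ^ 2 + ((2 * l.natAbs : ℕ) : ℝ) ^ 2 * (A₂ r / r) ^ 2)
      (radialMeasure R) :=
    h₂.deriv_memLp.integrable_sq.add (h₂.div_memLp.integrable_sq.const_mul _)
  have hi3 := integrable_interaction hR h₁.ac h₂.ac
  have hi4 : Integrable (fun r => 1 / 2 * (deriv A₁ r ^ 2 + (l.natAbs : ℝ) ^ 2 * (A₁ r / r) ^ 2)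
      + 1 / 4 * (deriv A₂ r ^ 2 + ((2 * l.natAbs : ℕ) : ℝ) ^ 2 * (A₂ r / r) ^ 2))
      (radialMeasure R) := (hi1.const_mul _).add (hi2.const_mul _)
  rw [← integral_const_mul, ← integral_const_mul, ← integral_const_mul,
    ← integral_add (hi1.const_mul _) (hi2.const_mul _), ← integral_sub hi4 hi3]
  refine integral_congr_ae (ae_of_all _ fun r => ?_)
  push_cast
  simp only [mul_pow, hl, div_pow]
  ring

lemma action_abs_le (hR : 0 < R) (l : ℤ) {A₁ A₂ : ℝ → ℝ} (h₁ : FiniteEnergy R A₁)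
    (h₂ : FiniteEnergy R A₂) :
    action l R (fun r => |A₁ r|) (fun r => |A₂ r|) ≤ action l R A₁ A₂ := by
  rw [action, action, intervalIntegral_eq_radialMeasure hR (fun r => deriv A₁ r ^ 2
      + (1 / 2) * deriv A₂ r ^ 2 + (l : ℝ) ^ 2 / r ^ 2 * A₁ r ^ 2
      + 2 * (l : ℝ) ^ 2 / r ^ 2 * A₂ r ^ 2 - 2 * A₁ r ^ 2 * A₂ r),
    intervalIntegral_eq_radialMeasure hR (fun r => deriv (fun r => |A₁ r|) r ^ 2
      + (1 / 2) * deriv (fun r => |A₂ r|) r ^ 2 + (l : ℝ) ^ 2 / r ^ 2 * |A₁ r| ^ 2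
      + 2 * (l : ℝ) ^ 2 / r ^ 2 * |A₂ r| ^ 2 - 2 * |A₁ r| ^ 2 * |A₂ r|)]
  have hint : ∀ {B₁ B₂ : ℝ → ℝ}, FiniteEnergy R B₁ → FiniteEnergy R B₂ → Integrable (fun r =>
      deriv B₁ r ^ 2 + (1 / 2) * deriv B₂ r ^ 2 + (l : ℝ) ^ 2 / r ^ 2 * B₁ r ^ 2
      + 2 * (l : ℝ) ^ 2 / r ^ 2 * B₂ r ^ 2 - 2 * B₁ r ^ 2 * B₂ r) (radialMeasure R) := by
    intro B₁ B₂ k₁ k₂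
    refine ((((k₁.deriv_memLp.integrable_sq.add (k₂.deriv_memLp.integrable_sq.const_mul (1 / 2))).add
      (k₁.div_memLp.integrable_sq.const_mul ((l : ℝ) ^ 2))).add
      (k₂.div_memLp.integrable_sq.const_mul (2 * (l : ℝ) ^ 2))).sub
      ((integrable_interaction hR k₁.ac k₂.ac).const_mul 2)).congr (ae_of_all _ fun r => ?_)
    simp only [Pi.add_apply, Pi.sub_apply, div_pow]
    ring
  refine mul_le_mul_of_nonneg_left ?_ (by norm_num)
  refine integral_mono_ae (hint (h₁.abs hR) (h₂.abs hR)) (hint h₁ h₂) ?_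
  filter_upwards [h₁.abs_deriv_abs_le hR, h₂.abs_deriv_abs_le hR] with r e₁ e₂
  have e₁' := sq_le_sq.2 e₁
  have e₂' := sq_le_sq.2 e₂
  have e₃ := mul_le_mul_of_nonneg_left (le_abs_self (A₂ r)) (sq_nonneg (A₁ r))
  simp only [sq_abs]
  linarith

end Admissible

/-! ### Nonnegative minimizers -/

section Minimizers

variable {R : ℝ} {l : ℤ} {q₁ q₂ : ℝ} {g₁ g₂ : RadialL2 R}

/-- The Euler–Lagrange equations and the regularity of a minimizing pair: the functions
`Aᵢ = radialEval gᵢ` are classical solutions, and `gᵢ` is the Hilbert space variable of `Aᵢ`. -/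
lemma IsHilbertMinimizer.exists_isClassicalSolution (hR : 0 < R) (hl : l ≠ 0) (hq₁ : 0 < q₁)
    (hq₂ : 0 < q₂) (hg : IsHilbertMinimizer (radialMeasure R) (radialEval l.natAbs R)
      (radialEval (2 * l.natAbs) R) q₁ q₂ g₁ g₂) :
    ∃ (Λ₁ Λ₂ : ℝ) (A₁ A₂ : ℝ → ℝ), (∀ r, A₁ r = radialEval l.natAbs R r g₁) ∧
      (∀ r, A₂ r = radialEval (2 * l.natAbs) R r g₂) ∧
      IsClassicalSolution l.natAbs R (fun r => 2 * A₂ r * A₁ r + Λ₁ * A₁ r) A₁ ∧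
      IsClassicalSolution (2 * l.natAbs) R (fun r => 2 * A₁ r ^ 2 + Λ₂ * A₂ r) A₂ ∧
      Represents l.natAbs R A₁ g₁ ∧ Represents (2 * l.natAbs) R A₂ g₂ ∧
      (∀ k, ⟪g₁, k⟫_ℝ = ∫ r, 2 * A₂ r * A₁ r * radialEval l.natAbs R r k ∂radialMeasure R
        + Λ₁ * ∫ r, A₁ r * radialEval l.natAbs R r k ∂radialMeasure R) ∧
      (∀ k, ⟪g₂, k⟫_ℝ = 2 * ∫ r, A₁ r ^ 2 * radialEval (2 * l.natAbs) R r k ∂radialMeasure R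
        + Λ₂ * ∫ r, A₂ r * radialEval (2 * l.natAbs) R r k ∂radialMeasure R) := by
  have hn₁ : l.natAbs ≠ 0 := Int.natAbs_ne_zero.2 hl
  have hn₂ : 2 * l.natAbs ≠ 0 := mul_ne_zero two_ne_zero hn₁
  have h₁ := isBoundedEvaluation_radialEval (R := R) hn₁
  have h₂ := isBoundedEvaluation_radialEval (R := R) hn₂
  obtain ⟨Λ₁, hΛ₁⟩ := hg.exists_multiplier₁ h₁ h₂ hq₁
  obtain ⟨Λ₂, hΛ₂⟩ := hg.exists_multiplier₂ h₁ h₂ hq₂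
  obtain ⟨C₁, hC₁, hb₁⟩ := h₁.exists_abs_le
  obtain ⟨C₂, hC₂, hb₂⟩ := h₂.exists_abs_le
  set A₁ : ℝ → ℝ := fun r => radialEval l.natAbs R r g₁ with hA₁
  set A₂ : ℝ → ℝ := fun r => radialEval (2 * l.natAbs) R r g₂ with hA₂
  have hc₁ : ContinuousOn A₁ (Ioo 0 R) := continuousOn_radialEval _ g₁
  have hc₂ : ContinuousOn A₂ (Ioo 0 R) := continuousOn_radialEval _ g₂
  have hB₁ : ∀ r, |A₁ r| ≤ C₁ * ‖g₁‖ := fun r => hb₁ r g₁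
  have hB₂ : ∀ r, |A₂ r| ≤ C₂ * ‖g₂‖ := fun r => hb₂ r g₂
  have hF₁ : ∀ r, |2 * A₂ r * A₁ r + Λ₁ * A₁ r|
      ≤ 2 * (C₂ * ‖g₂‖) * (C₁ * ‖g₁‖) + |Λ₁| * (C₁ * ‖g₁‖) := fun r => by
    refine (abs_add_le _ _).trans ?_
    rw [abs_mul, abs_mul, abs_mul, abs_two]
    gcongr
    exacts [hB₂ r, hB₁ r, hB₁ r]
  have hF₂ : ∀ r, |2 * A₁ r ^ 2 + Λ₂ * A₂ r|
      ≤ 2 * (C₁ * ‖g₁‖) ^ 2 + |Λ₂| * (C₂ * ‖g₂‖) := fun r => by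
    refine (abs_add_le _ _).trans ?_
    rw [abs_mul, abs_mul, abs_pow, abs_two]
    gcongr
    exacts [hB₁ r, hB₂ r]
  have hi : ∀ {u v w : ℝ → ℝ}, MemLp u ⊤ (radialMeasure R) → MemLp v ⊤ (radialMeasure R) →
      MemLp w ⊤ (radialMeasure R) → Integrable (fun r => u r * v r * w r) (radialMeasure R) :=
    fun hu hv hw => (memLp_top_mul (memLp_top_mul hu hv) hw).integrable le_top
  have hm₁ := h₁.memLp g₁
  have hm₂ := h₂.memLp g₂
  have h1 : MemLp (fun _ : ℝ => (1 : ℝ)) ⊤ (radialMeasure R) := memLp_top_const 1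
  have hW₁ : ∀ k, ⟪g₁, k⟫_ℝ = ∫ r, (2 * A₂ r * A₁ r + Λ₁ * A₁ r) * radialEval l.natAbs R r k
      ∂radialMeasure R := fun k => by
    rw [hΛ₁ k, ← integral_const_mul, ← integral_add]
    · exact integral_congr_ae (ae_of_all _ fun r => by simp only [hA₁, hA₂]; ring)
    · exact ((hi hm₂ hm₁ (h₁.memLp k)).const_mul 2).congr
        (ae_of_all _ fun r => by simp only []; ring)
    · exact ((hi h1 hm₁ (h₁.memLp k)).const_mul Λ₁).congr
        (ae_of_all _ fun r => by simp only []; ring)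
  have hW₂ : ∀ k, ⟪g₂, k⟫_ℝ = ∫ r, (2 * A₁ r ^ 2 + Λ₂ * A₂ r) * radialEval (2 * l.natAbs) R r k
      ∂radialMeasure R := fun k => by
    rw [hΛ₂ k, ← integral_const_mul, ← integral_const_mul, ← integral_add]
    · exact integral_congr_ae (ae_of_all _ fun r => by simp only [hA₁, hA₂]; ring)
    · exact ((hi hm₁ hm₁ (h₂.memLp k)).const_mul 2).congr
        (ae_of_all _ fun r => by simp only []; ring)
    · exact ((hi h1 hm₂ (h₂.memLp k)).const_mul Λ₂).congr
        (ae_of_all _ fun r => by simp only []; ring)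
  obtain ⟨hS₁, hG₁⟩ := isClassicalSolution_of_inner_eq hR hn₁ hF₁
    (((continuousOn_const.mul hc₂).mul hc₁).add (continuousOn_const.mul hc₁)) hW₁
  obtain ⟨hS₂, hG₂⟩ := isClassicalSolution_of_inner_eq hR hn₂ hF₂
    ((continuousOn_const.mul (hc₁.pow 2)).add (continuousOn_const.mul hc₂)) hW₂
  exact ⟨Λ₁, Λ₂, A₁, A₂, fun _ => rfl, fun _ => rfl, hS₁, hS₂, hG₁, hG₂, hΛ₁, hΛ₂⟩

lemma mass_eq_of_abs_eq (hR : 0 < R) {n : ℕ} {A : ℝ → ℝ} {g k : RadialL2 R}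
    (hA : FiniteEnergy R A) (hg : Represents n R A g) (hk : Represents n R (fun r => |A r|) k) :
    mass (radialMeasure R) (radialEval n R) k = mass (radialMeasure R) (radialEval n R) g := by
  have h1 := hk.flux_eq (hA.abs hR) hR
  have h2 := hg.flux_eq hA hR
  have h3 : flux R (fun r => |A r|) = flux R A := by simp only [flux, sq_abs]
  have : (2 * Real.pi) ≠ 0 := by positivity
  exact mul_left_cancel₀ this (by rw [← h1, ← h2, h3])

/-- Replacing a minimizing pair by its absolute values yields a minimizing pair of nonnegative
functions. -/
lemma exists_nonneg_isHilbertMinimizer (hR : 0 < R) (hl : l ≠ 0) (hq₁ : 0 < q₁) (hq₂ : 0 < q₂) :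
    ∃ k₁ k₂, IsHilbertMinimizer (radialMeasure R) (radialEval l.natAbs R)
      (radialEval (2 * l.natAbs) R) q₁ q₂ k₁ k₂ ∧
      (∀ r, 0 ≤ radialEval l.natAbs R r k₁) ∧ ∀ r, 0 ≤ radialEval (2 * l.natAbs) R r k₂ := by
  have hn₁ : l.natAbs ≠ 0 := Int.natAbs_ne_zero.2 hl
  have hn₂ : 2 * l.natAbs ≠ 0 := mul_ne_zero two_ne_zero hn₁
  have : Fact ((2 : ENNReal) ≠ ⊤) := ⟨by simp⟩
  obtain ⟨g₁, g₂, hg⟩ := exists_isHilbertMinimizer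
    (isBoundedEvaluation_radialEval (R := R) hn₁) (isBoundedEvaluation_radialEval (R := R) hn₂)
    (exists_mass_radialEval_eq hR hn₁ hq₁) (exists_mass_radialEval_eq hR hn₂ hq₂)
  obtain ⟨_, _, A₁, A₂, -, -, hS₁, hS₂, hr₁, hr₂, -, -⟩ :=
    hg.exists_isClassicalSolution hR hl hq₁ hq₂
  have hE₁ := hS₁.finiteEnergy
  have hE₂ := hS₂.finiteEnergy
  obtain ⟨k₁, hk₁⟩ := (hE₁.abs hR).exists_represents l.natAbs
  obtain ⟨k₂, hk₂⟩ := (hE₂.abs hR).exists_represents (2 * l.natAbs)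
  have hnn : ∀ {n : ℕ} {A : ℝ → ℝ} {k : RadialL2 R}, FiniteEnergy R A →
      Represents n R (fun r => |A r|) k → ∀ r, 0 ≤ radialEval n R r k := fun hA hk r => by
    by_cases hr : r ∈ Ioo 0 R
    · rw [hk.radialEval_eq (hA.abs hR) (Ioo_subset_Icc_self hr)]; exact abs_nonneg _
    · rw [radialEval_of_notMem _ hr]
  refine ⟨k₁, k₂, ⟨?_, ?_, fun b₁ b₂ hb₁ hb₂ => ?_⟩, hnn hE₁ hk₁, hnn hE₂ hk₂⟩
  · rw [mass_eq_of_abs_eq hR hE₁ hr₁ hk₁, hg.mass₁]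
  · rw [mass_eq_of_abs_eq hR hE₂ hr₂ hk₂, hg.mass₂]
  · refine le_trans ?_ (hg.minimal b₁ b₂ hb₁ hb₂)
    rw [← action_eq_hilbertAction hR l hE₁ hE₂ hr₁ hr₂,
      ← action_eq_hilbertAction hR l (hE₁.abs hR) (hE₂.abs hR) hk₁ hk₂]
    exact action_abs_le hR l hE₁ hE₂

end Minimizers

/-! ### Strict positivity -/

section Positivity

variable {R : ℝ}

/-- Uniqueness for the Cauchy problem of a second order linear equation on an open interval. -/
lemma eq_zero_of_linear_ode {a b : ℝ} {p q y y' : ℝ → ℝ} (hp : ContinuousOn p (Ioo a b))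
    (hq : ContinuousOn q (Ioo a b)) (hy : ∀ t ∈ Ioo a b, HasDerivAt y (y' t) t)
    (hy' : ∀ t ∈ Ioo a b, HasDerivAt y' (p t * y t + q t * y' t) t) {t₀ : ℝ}
    (ht₀ : t₀ ∈ Ioo a b) (h0 : y t₀ = 0) (h0' : y' t₀ = 0) : ∀ t ∈ Ioo a b, y t = 0 := by
  intro t ht
  -- a compact interval around both points, on which the coefficients are bounded
  obtain ⟨c, hc, hc'⟩ := exists_between (lt_min ht.1 ht₀.1)
  obtain ⟨d, hd', hd⟩ := exists_between (max_lt ht.2 ht₀.2)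
  have hsub : Icc c d ⊆ Ioo a b := fun x hx => ⟨hc.trans_le hx.1, hx.2.trans_lt hd⟩
  obtain ⟨P, hP⟩ := isCompact_Icc.exists_bound_of_continuousOn (hp.mono hsub)
  obtain ⟨Q, hQ⟩ := isCompact_Icc.exists_bound_of_continuousOn (hq.mono hsub)
  have ht₀' : t₀ ∈ Ioo c d :=
    ⟨hc'.trans_le (min_le_right _ _), (le_max_right _ _).trans_lt hd'⟩
  have ht' : t ∈ Icc c d :=
    ⟨(hc'.trans_le (min_le_left _ _)).le, ((le_max_left _ _).trans_lt hd').le⟩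
  have hP0 : 0 ≤ P := (norm_nonneg _).trans (hP t ht')
  have hQ0 : 0 ≤ Q := (norm_nonneg _).trans (hQ t ht')
  have hK : 0 ≤ 1 + P + Q := by positivity
  have huniq := ODE_solution_unique_of_mem_Icc (v := fun t (z : ℝ × ℝ) => (z.2, p t * z.1 + q t * z.2))
    (s := fun _ => univ) (K := ⟨1 + P + Q, hK⟩) (f := fun t => (y t, y' t)) (g := fun _ => 0)
    (a := c) (b := d) ?_ ht₀' ?_ ?_ (fun _ _ => mem_univ _) continuousOn_const ?_
    (fun _ _ => mem_univ _) (by simp [h0, h0'])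
  · simpa using congrArg Prod.fst (huniq ht')
  · intro s hs
    have hs' := Ioo_subset_Icc_self hs
    refine LipschitzOnWith.of_dist_le_mul fun z _ w _ => ?_
    have h1 : |z.1 - w.1| ≤ dist z w := by
      rw [← Real.dist_eq]; exact le_max_left _ _
    have h2 : |z.2 - w.2| ≤ dist z w := by
      rw [← Real.dist_eq]; exact le_max_right _ _
    have hPs := hP s hs'
    have hQs := hQ s hs'
    rw [Real.norm_eq_abs] at hPs hQs
    rw [Prod.dist_eq]
    change max (dist z.2 w.2) (dist (p s * z.1 + q s * z.2) (p s * w.1 + q s * w.2))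
      ≤ (1 + P + Q) * dist z w
    have hD : 0 ≤ dist z w := dist_nonneg
    refine max_le ?_ ?_
    · rw [Real.dist_eq]
      nlinarith [mul_nonneg hP0 hD, mul_nonneg hQ0 hD]
    · rw [Real.dist_eq]
      have : p s * z.1 + q s * z.2 - (p s * w.1 + q s * w.2)
          = p s * (z.1 - w.1) + q s * (z.2 - w.2) := by ring
      rw [this]
      refine (abs_add_le _ _).trans ?_
      rw [abs_mul, abs_mul]
      have e1 := mul_le_mul hPs h1 (abs_nonneg _) hP0
      have e2 := mul_le_mul hQs h2 (abs_nonneg _) hQ0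
      nlinarith
  · exact fun s hs => ((hy s (hsub hs)).prodMk (hy' s (hsub hs))).continuousAt.continuousWithinAt
  · exact fun s hs => (hy s (hsub (Ioo_subset_Icc_self hs))).prodMk
      (hy' s (hsub (Ioo_subset_Icc_self hs)))
  · intro s _
    simpa using! hasDerivAt_const s (0 : ℝ × ℝ)

lemma IsClassicalSolution.hasDerivAt_deriv {n : ℕ} {F A : ℝ → ℝ}
    (h : IsClassicalSolution n R F A) {r : ℝ} (hr : r ∈ Ioo 0 R) :
    HasDerivAt A (deriv A r) r ∧ HasDerivAt (deriv A) (deriv (deriv A) r) r := by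
  have h2 := h.contDiffOn.contDiffAt (isOpen_Ioo.mem_nhds hr)
  refine ⟨(h2.differentiableAt two_ne_zero).hasDerivAt, ?_⟩
  have := (contDiffOn_succ_iff_deriv_of_isOpen (n := 1) isOpen_Ioo).1
    (by simpa [one_add_one_eq_two] using h.contDiffOn)
  exact ((this.2.2.contDiffAt (isOpen_Ioo.mem_nhds hr)).differentiableAt one_ne_zero).hasDerivAt

/-- A nonnegative solution of a linear equation `A'' + A'/r - n² A/r² = -V A` has no zero in
`(0, R)` unless it vanishes identically there. -/
lemma IsClassicalSolution.pos_of_linear {n : ℕ} {V A : ℝ → ℝ} (hV : ContinuousOn V (Ioo 0 R))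
    (h : IsClassicalSolution n R (fun r => V r * A r) A) (h0 : ∀ r, 0 ≤ A r)
    (hne : ∃ r ∈ Ioo 0 R, A r ≠ 0) : ∀ r ∈ Ioo 0 R, 0 < A r := by
  intro r hr
  refine (h0 r).lt_of_ne' fun hz => ?_
  obtain ⟨s, hs, hsne⟩ := hne
  have hmin : IsLocalMin A r := Eventually.of_forall fun x => by rw [hz]; exact h0 x
  refine hsne (eq_zero_of_linear_ode (p := fun r => (n : ℝ) ^ 2 / r ^ 2 - V r) (q := fun r => -(1 / r))
    (y' := deriv A) ?_ ?_ (fun t ht => (h.hasDerivAt_deriv ht).1) (fun t ht => ?_) hr hz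
    hmin.deriv_eq_zero s hs)
  · exact (continuousOn_const.div (by fun_prop) fun r hr => pow_ne_zero _ hr.1.ne').sub hV
  · exact (continuousOn_const.div continuousOn_id fun r hr => hr.1.ne').neg
  · refine (h.hasDerivAt_deriv ht).2.congr_deriv ?_
    have := h.equation t ht
    linarith

/-- A nonnegative solution of `A'' + A'/r - n² A/r² = -F` has no zero at which `F > 0`: there `A`
would have a minimum with negative second derivative. -/
lemma IsClassicalSolution.pos_of_source {n : ℕ} {F A : ℝ → ℝ} (h : IsClassicalSolution n R F A)
    (h0 : ∀ r, 0 ≤ A r) {r : ℝ} (hr : r ∈ Ioo 0 R) (hF : A r = 0 → 0 < F r) : 0 < A r := by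
  refine (h0 r).lt_of_ne' fun hz => ?_
  have hmin : IsLocalMin A r := Eventually.of_forall fun x => by rw [hz]; exact h0 x
  have hd := hmin.deriv_eq_zero
  have hdd : deriv (deriv A) r = -F r := by
    have := h.equation r hr
    rw [hd, hz] at this
    linarith
  have hneg : deriv (deriv A) r < 0 := by rw [hdd]; linarith [hF hz]
  have hmax := isLocalMax_of_deriv_deriv_neg hneg hd (h.hasDerivAt_deriv hr).1.continuousAt
  have hzero : A =ᶠ[𝓝 r] fun _ => 0 := by
    filter_upwards [hmax] with x hx
    exact le_antisymm (hx.trans hz.le) (h0 x)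
  have : deriv (deriv A) r = 0 := by
    rw [hzero.deriv.deriv_eq]; simp
  exact hneg.ne this

end Positivity

end Vortex

end

theorem theorem1p1 (l : ℤ) (hl : l ≠ 0) (R : ℝ) (hR : 0 < R) (Q₁ Q₂ : ℝ)
    (hQ₁ : 0 < Q₁) (hQ₁l : Q₁ < 2 * Real.pi * |(l : ℝ)|) (hQ₂ : 0 < Q₂) :
    ∃ (κ β : ℝ) (A₁ A₂ : ℝ → ℝ),
      Vortex.IsVortexSolution l R κ β A₁ A₂ ∧
      (∀ r ∈ Ioo 0 R, 0 < A₁ r ∧ 0 < A₂ r) ∧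
      Vortex.IsConstrainedMinimizer l R Q₁ Q₂ A₁ A₂ ∧
      Vortex.AreLagrangeMultipliers l R A₁ A₂
        (-κ / (2 * Real.pi)) (-(2 * κ + β) / (2 * Real.pi)) := by
  open Vortex in
  have hpi : 0 < 2 * Real.pi := by positivity
  have hq₁ : 0 < Q₁ / (2 * Real.pi) := by positivity
  have hq₂ : 0 < Q₂ / (2 * Real.pi) := by positivity
  obtain ⟨g₁, g₂, hg, hnn₁, hnn₂⟩ := exists_nonneg_isHilbertMinimizer hR hl hq₁ hq₂
  obtain ⟨Λ₁, Λ₂, A₁, A₂, hA₁, hA₂, hS₁, hS₂, hr₁, hr₂, hΛ₁, hΛ₂⟩ :=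
    hg.exists_isClassicalSolution hR hl hq₁ hq₂
  have hE₁ := hS₁.finiteEnergy
  have hE₂ := hS₂.finiteEnergy
  have hn₁ : l.natAbs ≠ 0 := Int.natAbs_ne_zero.2 hl
  have hn₂ : 2 * l.natAbs ≠ 0 := mul_ne_zero two_ne_zero hn₁
  have hb₁ := isBoundedEvaluation_radialEval (R := R) hn₁
  have hb₂ := isBoundedEvaluation_radialEval (R := R) hn₂
  have hlsq : ((l.natAbs : ℕ) : ℝ) ^ 2 = (l : ℝ) ^ 2 := by
    rw [Nat.cast_natAbs, Int.cast_abs, sq_abs]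
  have hpos₁ : ∀ r ∈ Ioo 0 R, 0 < A₁ r := by
    have hlin : IsClassicalSolution l.natAbs R (fun r => (2 * A₂ r + Λ₁) * A₁ r) A₁ := by
      simpa only [add_mul] using hS₁
    refine hlin.pos_of_linear ((continuousOn_const.mul
      ((hE₂.continuousOn hR).mono Ioo_subset_Icc_self)).add continuousOn_const)
      (fun r => hA₁ r ▸ hnn₁ r) ?_
    by_contra! hzero
    have hm : mass (radialMeasure R) (radialEval l.natAbs R) g₁ = 0 := by
      rw [mass, ← integral_zero ℝ ℝ (μ := radialMeasure R)]
      refine integral_congr_ae ?_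
      filter_upwards [ae_radialMeasure_mem] with r hr
      rw [← hA₁, hzero r hr, zero_pow two_ne_zero]
    exact hq₁.ne' (hg.mass₁ ▸ hm)
  have hpos₂ : ∀ r ∈ Ioo 0 R, 0 < A₂ r := fun r hr =>
    hS₂.pos_of_source (fun r => hA₂ r ▸ hnn₂ r) hr fun hz => by
      have := pow_pos (hpos₁ r hr) 2
      change 0 < 2 * A₁ r ^ 2 + Λ₂ * A₂ r
      rw [hz]
      linarith
  refine ⟨-Λ₁ / 2, Λ₁ - Λ₂ / 4, A₁, A₂, ⟨hE₁.continuousOn hR, hE₂.continuousOn hR, hS₁.contDiffOn,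
    hS₂.contDiffOn, fun r hr => ?_, fun r hr => ?_, ⟨hE₁.left, hE₁.right, hE₂.left, hE₂.right⟩⟩,
    fun r hr => ⟨hpos₁ r hr, hpos₂ r hr⟩, ⟨(admissible_iff hR).2 ⟨hE₁, hE₂⟩, ?_, ?_, ?_⟩, ?_⟩
  · have := hS₁.equation r hr
    rw [hlsq] at this
    rw [this]; ring
  · have := hS₂.equation r hr
    push_cast at this
    rw [mul_pow, hlsq, show ((2 : ℝ) ^ 2) = 4 by norm_num] at this
    rw [this]; ring
  · rw [hr₁.flux_eq hE₁ hR, hg.mass₁]; field_simp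
  · rw [hr₂.flux_eq hE₂ hR, hg.mass₂]; field_simp
  · intro B₁ B₂ hB hB₁ hB₂
    obtain ⟨hF₁, hF₂⟩ := (admissible_iff hR).1 hB
    obtain ⟨k₁, hk₁⟩ := hF₁.exists_represents l.natAbs
    obtain ⟨k₂, hk₂⟩ := hF₂.exists_represents (2 * l.natAbs)
    rw [action_eq_hilbertAction hR l hE₁ hE₂ hr₁ hr₂,
      action_eq_hilbertAction hR l hF₁ hF₂ hk₁ hk₂]
    refine hg.minimal k₁ k₂ ?_ ?_
    · rw [← hB₁, hk₁.flux_eq hF₁ hR]; field_simp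
    · rw [← hB₂, hk₂.flux_eq hF₂ hR]; field_simp
  · intro φ₁ φ₂ hφ
    obtain ⟨hF₁, hF₂⟩ := (admissible_iff hR).1 hφ
    obtain ⟨k₁, hk₁⟩ := hF₁.exists_represents l.natAbs
    obtain ⟨k₂, hk₂⟩ := hF₂.exists_represents (2 * l.natAbs)
    have hact : ∀ t : ℝ, action l R (fun r => A₁ r + t * φ₁ r) (fun r => A₂ r + t * φ₂ r) = _ :=
      fun t => (action_eq_hilbertAction hR l (hE₁.add_smul hF₁ hR t) (hE₂.add_smul hF₂ hR t)
        (hr₁.add_smul hk₁ hE₁ hF₁ hR t) (hr₂.add_smul hk₂ hE₂ hF₂ hR t)).trans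
        (hilbertAction_add_smul hb₁ hb₂ g₁ g₂ k₁ k₂ t)
    have hflux : ∀ {n : ℕ} {A φ : ℝ → ℝ} {g k : RadialL2 R},
        IsBoundedEvaluation (radialMeasure R) (radialEval n R) → FiniteEnergy R A →
        FiniteEnergy R φ → Represents n R A g → Represents n R φ k →
        HasDerivAt (fun t : ℝ => flux R (fun r => A r + t * φ r))
          (2 * Real.pi * (2 * ∫ r, radialEval n R r g * radialEval n R r k ∂radialMeasure R)) 0 := by
      intro n A φ g k hb hA hφ hg hk
      have := (hasDerivAt_cubic (mass (radialMeasure R) (radialEval n R) g)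
        (2 * ∫ r, radialEval n R r g * radialEval n R r k ∂radialMeasure R)
        (mass (radialMeasure R) (radialEval n R) k) 0).const_mul (2 * Real.pi)
      refine this.congr_of_eventuallyEq (Filter.Eventually.of_forall fun t => ?_)
      simp only [(hg.add_smul hk hA hφ hR t).flux_eq (hA.add_smul hφ hR t) hR, mass_add_smul hb,
        mul_zero, sub_zero]
    refine ⟨_, _, _, (hasDerivAt_cubic _ _ _ _).congr_of_eventuallyEq (Filter.Eventually.of_forall hact),
      hflux hb₁ hE₁ hF₁ hr₁ hk₁, hflux hb₂ hE₂ hF₂ hr₂ hk₂, ?_⟩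
    rw [hΛ₁ k₁, hΛ₂ k₂]
    simp only [← hA₁, ← hA₂]
    field_simp
    ring
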